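/- Let $\mathbb D$ be the open unit disc, $\mathbb T$ the unit circle, let $\mu_1,\mu_2$ be finite positive Borel measures on $\mathbb T$, and put $\boldsymbol\mu=\mu_1\times\mu_2$. Write $$P_{\mu_i}(z)=\frac1{2\pi}\int_{\mathbb T}\frac{1-|z|^2}{|\xi-z|^2}\,d\mu_i(\xi)\qquad(z\in\mathbb D),$$ let $dA$ be the normalized area measure on $\mathbb D$, and for $f$ holomorphic on $\mathbb D^2$ let $$D_{\boldsymbol\mu}(f)=\lim_{r\to1^-}\frac1{2\pi}\int_0^{2\pi}\!\!\int_{\mathbb D}|\partial_1f(z_1,re^{it})|^2P_{\mu_1}(z_1)\,dA(z_1)\,dt+\lim_{r\to1^-}\frac1{2\pi}\int_0^{2\pi}\!\!\int_{\mathbb D}|\partial_2f(re^{it},z_2)|^2P_{\mu_2}(z_2)\,dA(z_2)\,dt+\iint_{\mathbb D^2}|\partial_1\partial_2f(z_1,z_2)|^2P_{\mu_1}(z_1)P_{\mu_2}(z_2)\,dA(z_1)\,dA(z_2),$$ $$\|f\|_{H^2(\mathbb D^2)}^2=\sup_{0<r<1}\frac1{(2\pi)^2}\int_0^{2\pi}\!\!\int_0^{2\pi}|f(re^{is},re^{it})|^2\,ds\,dt.$$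 If $\boldsymbol\mu\neq0$, let $\mathcal D^2(\boldsymbol\mu)$ be the space of holomorphic functions $f$ on $\mathbb D^2$ with $D_{\boldsymbol\mu}(f)<\infty$, with the norm given by $\|f\|_{\boldsymbol\mu}^2=\|f\|_{H^2(\mathbb D^2)}^2+D_{\boldsymbol\mu}(f)$; if $\boldsymbol\mu=0$, let $\mathcal D^2(\boldsymbol\mu)$ be the Hardy space $H^2(\mathbb D^2)$ with its norm. **Theorem.** The set of all polynomials in $z_1,z_2$ with complex coefficients is dense in $\mathcal D^2(\boldsymbol\mu)$. That is, every polynomial belongs to $\mathcal D^2(\boldsymbol\mu)$, and for every $f\in\mathcal D^2(\boldsymbol\mu)$ one has $\|f\|_{\boldsymbol\mu}<\infty$ and, for every $\varepsilon>0$, there is a polynomial $p$ with $\|f-p\|_{\boldsymbol\mu}<\varepsilon$. -/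

import Mathlib

open MeasureTheory Set Filter Topology
open scoped ENNReal

noncomputable section

namespace BidiscDirichlet

/-- The open unit disc in the complex plane. -/
def disc : Set ℂ := Metric.ball 0 1

/-- The open unit bidisc. -/
def bidisc : Set (ℂ × ℂ) := disc ×ˢ disc

/-- The unit circle, with the topology and the Borel structure inherited from `ℂ`. -/
abbrev UnitCircle : Type := Metric.sphere (0 : ℂ) 1

/-- Normalized Lebesgue area measure on the open unit disc (total mass one). -/
def areaMeasure : Measure ℂ :=
  ENNReal.ofReal Real.pi⁻¹ • (volume : Measure ℂ).restrict disc

/-- The normalized angular measure, of density `1 / (2π)` on `(0, 2π]`. -/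
def angleMeasure : Measure ℝ :=
  ENNReal.ofReal (2 * Real.pi)⁻¹ • (volume : Measure ℝ).restrict (Ioc 0 (2 * Real.pi))

instance : IsProbabilityMeasure areaMeasure := by
  constructor
  have h : (NNReal.pi : ℝ≥0∞) = ENNReal.ofReal Real.pi := by
    rw [← NNReal.coe_real_pi, ENNReal.ofReal_coe_nnreal]
  simp only [areaMeasure, disc, Measure.smul_apply, Measure.restrict_apply_univ,
    Complex.volume_ball, smul_eq_mul, ENNReal.ofReal_one, one_pow, one_mul, h]
  rw [← ENNReal.ofReal_mul (inv_nonneg.mpr Real.pi_pos.le),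
    inv_mul_cancel₀ Real.pi_ne_zero, ENNReal.ofReal_one]

instance : IsProbabilityMeasure angleMeasure := by
  constructor
  have hp : (0 : ℝ) < 2 * Real.pi := by positivity
  simp only [angleMeasure, Measure.smul_apply, Measure.restrict_apply_univ,
    Real.volume_Ioc, smul_eq_mul, sub_zero]
  rw [← ENNReal.ofReal_mul (inv_nonneg.mpr hp.le), inv_mul_cancel₀ hp.ne', ENNReal.ofReal_one]

/-- The point `r e^{it}`. -/
def polar (r t : ℝ) : ℂ := r * Complex.exp (t * Complex.I)

/-- The Poisson integral `P_μ(z) = (1 / 2π) ∫ (1 - |z|²) / |ξ - z|² dμ(ξ)` of a measure on the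
unit circle, at a point `z` of the open unit disc. -/
def poissonIntegral (μ : Measure UnitCircle) (z : ℂ) : ℝ≥0∞ :=
  ENNReal.ofReal (2 * Real.pi)⁻¹ * ∫⁻ ξ : UnitCircle, ENNReal.ofReal (poissonKernel 0 z (ξ : ℂ)) ∂μ

/-- The kernel used above is the usual one. -/
theorem poissonKernel_circle (z : ℂ) (ξ : UnitCircle) :
    poissonKernel 0 z (ξ : ℂ) = (1 - ‖z‖ ^ 2) / ‖(ξ : ℂ) - z‖ ^ 2 := by
  simp [poissonKernel_def, norm_eq_of_mem_sphere ξ]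

/-- The partial derivative in the first variable. -/
def partialFst (f : ℂ × ℂ → ℂ) (z : ℂ × ℂ) : ℂ := deriv (fun w => f (w, z.2)) z.1

/-- The partial derivative in the second variable. -/
def partialSnd (f : ℂ × ℂ → ℂ) (z : ℂ × ℂ) : ℂ := deriv (fun w => f (z.1, w)) z.2

/-- `lim_{r → 1⁻} (1 / 2π) ∬_{𝔻 × 𝕋} |∂₁f(z₁, r e^{it})|² P_{μ₁}(z₁) dA(z₁) dt`.
For holomorphic `f` the integrals increase with `r`, so the limit exists in `[0, ∞]`, and the upper
limit written here is that limit. -/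
def dirichletFst (μ₁ : Measure UnitCircle) (f : ℂ × ℂ → ℂ) : ℝ≥0∞ :=
  limsup (fun r : ℝ =>
    ∫⁻ p : ℂ × ℝ, ‖partialFst f (p.1, polar r p.2)‖ₑ ^ 2 * poissonIntegral μ₁ p.1
      ∂(areaMeasure.prod angleMeasure)) (𝓝[<] 1)

/-- `lim_{r → 1⁻} (1 / 2π) ∬_{𝕋 × 𝔻} |∂₂f(r e^{it}, z₂)|² P_{μ₂}(z₂) dA(z₂) dt`;
the same remark on the limit applies. -/
def dirichletSnd (μ₂ : Measure UnitCircle) (f : ℂ × ℂ → ℂ) : ℝ≥0∞ :=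
  limsup (fun r : ℝ =>
    ∫⁻ p : ℝ × ℂ, ‖partialSnd f (polar r p.1, p.2)‖ₑ ^ 2 * poissonIntegral μ₂ p.2
      ∂(angleMeasure.prod areaMeasure)) (𝓝[<] 1)

/-- `∬_{𝔻²} |∂₁∂₂f(z₁, z₂)|² P_{μ₁}(z₁) P_{μ₂}(z₂) dA(z₁) dA(z₂)`. -/
def dirichletMixed (μ₁ μ₂ : Measure UnitCircle) (f : ℂ × ℂ → ℂ) : ℝ≥0∞ :=
  ∫⁻ z : ℂ × ℂ, ‖partialFst (partialSnd f) z‖ₑ ^ 2 *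
      (poissonIntegral μ₁ z.1 * poissonIntegral μ₂ z.2)
    ∂(areaMeasure.prod areaMeasure)

/-- The Dirichlet-type integral over the bidisc. -/
def dirichletIntegral (μ₁ μ₂ : Measure UnitCircle) (f : ℂ × ℂ → ℂ) : ℝ≥0∞ :=
  dirichletFst μ₁ f + dirichletSnd μ₂ f + dirichletMixed μ₁ μ₂ f

/-- The squared norm of the Hardy space of the bidisc:
`sup_{0 < r < 1} (1 / (2π)²) ∬ |f(r e^{is}, r e^{it})|² ds dt`. -/
def hardyNormSq (f : ℂ × ℂ → ℂ) : ℝ≥0∞ :=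
  ⨆ r ∈ Ioo (0 : ℝ) 1,
    ∫⁻ p : ℝ × ℝ, ‖f (polar r p.1, polar r p.2)‖ₑ ^ 2 ∂(angleMeasure.prod angleMeasure)

/-- The Hardy space `H²` of the bidisc. Functions are total on `ℂ × ℂ`, but only their values on
the bidisc play a role. -/
def hardySpace : Set (ℂ × ℂ → ℂ) :=
  {f | DifferentiableOn ℂ f bidisc ∧ hardyNormSq f < ∞}

open Classical in
/-- The Dirichlet-type space of the product measure `μ₁ × μ₂`: holomorphic functions with finite
Dirichlet-type integral, or the Hardy space when the product measure is zero. -/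
def dirichletSpace (μ₁ μ₂ : Measure UnitCircle) : Set (ℂ × ℂ → ℂ) :=
  if μ₁.prod μ₂ = 0 then hardySpace
  else {f | DifferentiableOn ℂ f bidisc ∧ dirichletIntegral μ₁ μ₂ f < ∞}

open Classical in
/-- The norm of the Dirichlet-type space, with values in `[0, ∞]`: the square root of
`‖f‖²_{H²} + D(f)`, and the norm of `H²` when the product measure is zero. -/
def dirichletNorm (μ₁ μ₂ : Measure UnitCircle) (f : ℂ × ℂ → ℂ) : ℝ≥0∞ :=
  if μ₁.prod μ₂ = 0 then hardyNormSq f ^ (1 / 2 : ℝ)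
  else (hardyNormSq f + dirichletIntegral μ₁ μ₂ f) ^ (1 / 2 : ℝ)

/-- The function on `ℂ × ℂ` given by a complex polynomial in two variables. -/
def polyFun (p : MvPolynomial (Fin 2) ℂ) (z : ℂ × ℂ) : ℂ :=
  MvPolynomial.eval ![z.1, z.2] p

end BidiscDirichlet

end

/-!
The squared norm of `𝒟²(μ₁ × μ₂)` is a sum of four terms, each of which is the supremum over
`0 < r < 1` of the integrals of `‖∂₁ⁱ ∂₂ʲ f‖²` against a product of two measures on the disc. The
factor belonging to a variable is arc length on the circle of radius `r` if the variable is not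
differentiated, and area with the weight `P_μ` if it is differentiated once (`energy`). Iterated
Fejér means of the Taylor series, in one variable after the other, are polynomials, and they
converge to `f` for each of these terms.

The heart of the matter is that Fejér means in one variable contract the Dirichlet integral with
weight `P_μ`. By Tonelli's theorem it suffices to treat the Poisson kernel `P_ξ` of a boundary point
`ξ`. As `|g'|² P_ξ = |g' / (1 - conj ξ z)|² (1 - |z|²)`, Parseval's identity shows that the
Dirichlet integral equals `∑ |B (n + 1)|² / ((n + 1) (n + 2))`, where
`B n = ∑_{1 ≤ k ≤ n} k a_k ξᵏ` (`lintegral_deriv_mul_poissonKernel`). In passing to the `N`-th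
Fejér mean, `B n` is replaced, for `n ≤ N`, by a convex combination of `B n` and the mean `d` of
`B 0, …, B (n - 1)`, and by a constant beyond `N`. The inequality between the two sums then follows
by telescoping, since termwise the difference exceeds an increment of `|d|² / N` by a nonnegative
multiple of `|B n - d|²` (`fejer_step`, `tsum_fejerWeight_le`).

Integrated over the other variable, the contraction gives `energy (S_N f) ≤ energy f` for the Fejér
means `S_N f` in the first variable; it uses that these commute with `∂₂`. The derivatives of
`S_N f` converge pointwise, so Fatou's lemma gives `4 energy f ≤ liminf energy (f + S_N f)`, and the
parallelogram law forces `energy (f - S_N f) → 0` (`tendsto_energy_sub_fejerFst`). The second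
variable is handled by exchanging the variables.

If neither measure vanishes, the finiteness of the Hardy norm follows from that of the Dirichlet
integral, because `P_μ` is bounded below by a multiple of `1 - |z|²` (`energy_circle_ne_top`).
-/

namespace BidiscDirichlet

/-! ### Parseval's identity on circles and on the disc -/

theorem integral_exp_int_mul (a : ℝ) (k : ℤ) :
    ∫ t in a..a + 2 * Real.pi, Complex.exp (k * Complex.I * t)
      = if k = 0 then (2 * Real.pi : ℂ) else 0 := by
  split_ifs with h
  · simp [h]
  · have hc : (k : ℂ) * Complex.I ≠ 0 := mul_ne_zero (by exact_mod_cast h) Complex.I_ne_zero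
    rw [integral_exp_mul_complex hc]
    have : Complex.exp (k * Complex.I * ((a + 2 * Real.pi : ℝ) : ℂ))
        = Complex.exp (k * Complex.I * a) := by
      rw [← Complex.exp_periodic.int_mul k (k * Complex.I * a)]
      congr 1
      push_cast
      ring
    rw [this, sub_self, zero_div]

theorem norm_exp_nat_mul (n : ℕ) (t : ℝ) : ‖Complex.exp (n * Complex.I * t)‖ = 1 := by
  have : (n : ℂ) * Complex.I * t = ((n * t : ℝ) : ℂ) * Complex.I := by push_cast; ring
  rw [this, Complex.norm_exp_ofReal_mul_I]

theorem continuous_tsum_exp {b : ℕ → ℂ} (hb : Summable fun n => ‖b n‖) :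
    Continuous fun t : ℝ => ∑' n : ℕ, b n * Complex.exp (n * Complex.I * t) := by
  refine continuous_tsum (fun n => by fun_prop) hb fun n t => ?_
  rw [norm_mul, norm_exp_nat_mul, mul_one]

theorem conj_exp_nat_mul (n : ℕ) (t : ℝ) :
    (starRingEnd ℂ) (Complex.exp (n * Complex.I * t)) = Complex.exp (-(n * Complex.I * t)) := by
  rw [← Complex.exp_conj]
  simp

/-- The Fourier coefficients of an absolutely convergent Fourier series. -/
theorem integral_tsum_mul_conj_exp {b : ℕ → ℂ} (hb : Summable fun n => ‖b n‖) (a : ℝ) (m : ℕ) :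
    ∫ t in a..a + 2 * Real.pi, (∑' n : ℕ, b n * Complex.exp (n * Complex.I * t))
        * (starRingEnd ℂ) (Complex.exp (m * Complex.I * t)) = 2 * Real.pi * b m := by
  have hle : a ≤ a + 2 * Real.pi := by linarith [Real.pi_pos]
  have hF : ∀ n : ℕ, Continuous fun t : ℝ => b n * Complex.exp (n * Complex.I * t)
      * (starRingEnd ℂ) (Complex.exp (m * Complex.I * t)) := fun n => by
    have := Complex.continuous_conj
    fun_prop
  have hnorm : ∀ (n : ℕ) (t : ℝ), ‖b n * Complex.exp (n * Complex.I * t)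
      * (starRingEnd ℂ) (Complex.exp (m * Complex.I * t))‖ = ‖b n‖ := fun n t => by
    rw [norm_mul, norm_mul, RCLike.norm_conj, norm_exp_nat_mul, norm_exp_nat_mul, mul_one, mul_one]
  have hsum := hasSum_integral_of_summable_integral_norm
    (μ := (volume : Measure ℝ).restrict (Ioc a (a + 2 * Real.pi)))
    (F := fun (n : ℕ) (t : ℝ) => b n * Complex.exp (n * Complex.I * t)
      * (starRingEnd ℂ) (Complex.exp (m * Complex.I * t)))
    (fun n => (hF n).integrableOn_Ioc) (by
      simp_rw [hnorm]
      simpa using hb.mul_left _)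
  rw [intervalIntegral.integral_of_le hle]
  simp_rw [tsum_mul_right] at hsum
  refine (hsum.unique ?_)
  have hterm : ∀ n : ℕ, ∫ t in Ioc a (a + 2 * Real.pi), b n * Complex.exp (n * Complex.I * t)
      * (starRingEnd ℂ) (Complex.exp (m * Complex.I * t))
        = if n = m then 2 * Real.pi * b m else 0 := fun n => by
    have : ∀ t : ℝ, b n * Complex.exp (n * Complex.I * t)
      * (starRingEnd ℂ) (Complex.exp (m * Complex.I * t))
        = b n * Complex.exp (((n - m : ℤ) : ℂ) * Complex.I * t) := fun t => by
      rw [conj_exp_nat_mul, mul_assoc, ← Complex.exp_add]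
      congr 2
      push_cast
      ring
    simp_rw [this]
    rw [integral_const_mul, ← intervalIntegral.integral_of_le hle, integral_exp_int_mul]
    by_cases h : n = m
    · simp [h, mul_comm]
    · have : (n : ℤ) - m ≠ 0 := by omega
      simp [h, this]
  simp_rw [hterm]
  exact hasSum_ite_eq m _

/-- Parseval's identity for an absolutely convergent Fourier series of analytic type, over an
arbitrary period. -/
theorem lintegral_sq_tsum_exp {b : ℕ → ℂ} (hb : Summable fun n => ‖b n‖) (a : ℝ) :
    ∫⁻ t in Ioc a (a + 2 * Real.pi), ‖∑' n : ℕ, b n * Complex.exp (n * Complex.I * t)‖ₑ ^ 2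
      = ENNReal.ofReal (2 * Real.pi) * ∑' n, ‖b n‖ₑ ^ 2 := by
  have hle : a ≤ a + 2 * Real.pi := by linarith [Real.pi_pos]
  set g : ℝ → ℂ := fun t => ∑' n : ℕ, b n * Complex.exp (n * Complex.I * t) with hg
  have hgc : Continuous g := continuous_tsum_exp hb
  have hgb : ∀ t, ‖g t‖ ≤ ∑' n, ‖b n‖ := fun t => by
    refine tsum_of_norm_bounded hb.hasSum fun n => ?_
    rw [norm_mul, norm_exp_nat_mul, mul_one]
  have hb2 : Summable fun n => ‖b n‖ ^ 2 :=
    (hb.of_norm_bounded_eventually (g := fun n => ‖b n‖) (by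
      have := hb.tendsto_atTop_zero
      rw [Nat.cofinite_eq_atTop]
      filter_upwards [this.eventually (gt_mem_nhds one_pos)] with n hn
      rw [norm_pow, norm_norm]
      nlinarith [norm_nonneg (b n)]))
  have key : ∫ t in Ioc a (a + 2 * Real.pi), ‖g t‖ ^ 2 = 2 * Real.pi * ∑' n, ‖b n‖ ^ 2 := by
    have hF : ∀ n : ℕ, Continuous fun t : ℝ => (starRingEnd ℂ) (b n) *
        (g t * (starRingEnd ℂ) (Complex.exp (n * Complex.I * t))) := fun n => by
      have := Complex.continuous_conj
      fun_prop
    have hsum := hasSum_integral_of_summable_integral_norm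
      (μ := (volume : Measure ℝ).restrict (Ioc a (a + 2 * Real.pi)))
      (F := fun (n : ℕ) (t : ℝ) => (starRingEnd ℂ) (b n) *
        (g t * (starRingEnd ℂ) (Complex.exp (n * Complex.I * t))))
      (fun n => (hF n).integrableOn_Ioc) (by
        have : ∀ (n : ℕ) (t : ℝ), ‖(starRingEnd ℂ) (b n) *
            (g t * (starRingEnd ℂ) (Complex.exp (n * Complex.I * t)))‖ = ‖b n‖ * ‖g t‖ :=
          fun n t => by
            rw [norm_mul, norm_mul, RCLike.norm_conj, RCLike.norm_conj, norm_exp_nat_mul, mul_one]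
        simp_rw [this, integral_const_mul]
        exact hb.mul_right _)
    have h1 : ∀ n : ℕ, ∫ t in Ioc a (a + 2 * Real.pi), (starRingEnd ℂ) (b n) *
        (g t * (starRingEnd ℂ) (Complex.exp (n * Complex.I * t)))
          = ((2 * Real.pi * ‖b n‖ ^ 2 : ℝ) : ℂ) := fun n => by
      rw [integral_const_mul, ← intervalIntegral.integral_of_le hle,
        integral_tsum_mul_conj_exp hb a n]
      push_cast
      rw [← Complex.mul_conj']
      ring
    have h2 : ∀ t : ℝ, ∑' n : ℕ, (starRingEnd ℂ) (b n) *
        (g t * (starRingEnd ℂ) (Complex.exp (n * Complex.I * t))) = ((‖g t‖ ^ 2 : ℝ) : ℂ) :=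
      fun t => by
        push_cast
        rw [← Complex.mul_conj', hg]
        simp only
        rw [Complex.conj_tsum, ← tsum_mul_left]
        refine tsum_congr fun n => ?_
        rw [map_mul]
        ring
    simp_rw [h1, h2] at hsum
    rw [integral_complex_ofReal] at hsum
    have := (Complex.hasSum_ofReal.mp hsum).tsum_eq
    rw [← this, tsum_mul_left]
  have hint : Integrable (fun t => ‖g t‖ ^ 2)
      ((volume : Measure ℝ).restrict (Ioc a (a + 2 * Real.pi))) :=
    (hgc.norm.pow 2).integrableOn_Ioc
  have h3 := ofReal_integral_eq_lintegral_ofReal hint (ae_of_all _ fun t => by positivity)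
  rw [key, ENNReal.ofReal_mul (by positivity), ENNReal.ofReal_tsum_of_nonneg
    (fun n => by positivity) hb2] at h3
  simpa only [ENNReal.ofReal_pow (norm_nonneg _), ofReal_norm] using h3.symm

/-- `a` is the sequence of coefficients of a power series converging to `g` on the unit disc. -/
def HasTaylor (a : ℕ → ℂ) (g : ℂ → ℂ) : Prop :=
  ∀ z ∈ disc, HasSum (fun n => a n * z ^ n) (g z)

theorem mem_disc {z : ℂ} : z ∈ disc ↔ ‖z‖ < 1 := mem_ball_zero_iff

theorem isOpen_disc : IsOpen disc := Metric.isOpen_ball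

theorem zero_mem_disc : (0 : ℂ) ∈ disc := by simp [mem_disc]

theorem norm_polar {r : ℝ} (hr : 0 ≤ r) (t : ℝ) : ‖polar r t‖ = r := by
  rw [polar, norm_mul, Complex.norm_exp_ofReal_mul_I, mul_one, Complex.norm_real,
    Real.norm_of_nonneg hr]

theorem polar_mem_disc {r : ℝ} (hr : r ∈ Ioo (0 : ℝ) 1) (t : ℝ) : polar r t ∈ disc := by
  rw [mem_disc, norm_polar hr.1.le]
  exact hr.2

theorem continuous_polar (r : ℝ) : Continuous (polar r) := by
  unfold polar
  fun_prop

theorem HasTaylor.summable_norm {a : ℕ → ℂ} {g : ℂ → ℂ} (h : HasTaylor a g) {z : ℂ}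
    (hz : z ∈ disc) : Summable fun n => ‖a n * z ^ n‖ :=
  (h z hz).summable.norm

theorem HasTaylor.lintegral_Ioc {a : ℕ → ℂ} {g : ℂ → ℂ} (h : HasTaylor a g) {r : ℝ}
    (hr : r ∈ Ioo (0 : ℝ) 1) (x : ℝ) :
    ∫⁻ t in Ioc x (x + 2 * Real.pi), ‖g (polar r t)‖ₑ ^ 2
      = ENNReal.ofReal (2 * Real.pi) * ∑' n, ‖a n‖ₑ ^ 2 * ENNReal.ofReal (r ^ (2 * n)) := by
  have hrd : (r : ℂ) ∈ disc := by
    rw [mem_disc, Complex.norm_real, Real.norm_of_nonneg hr.1.le]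
    exact hr.2
  have h1 := lintegral_sq_tsum_exp (h.summable_norm hrd) x
  have h2 : ∀ t : ℝ, g (polar r t)
      = ∑' n : ℕ, a n * (r : ℂ) ^ n * Complex.exp (n * Complex.I * t) := fun t => by
    rw [← (h _ (polar_mem_disc hr t)).tsum_eq]
    refine tsum_congr fun n => ?_
    rw [polar, mul_pow, ← Complex.exp_nat_mul, mul_assoc]
    congr 3
    ring
  simp_rw [h2, h1]
  congr 1
  refine tsum_congr fun n => ?_
  rw [enorm_mul, mul_pow, enorm_pow, ← pow_mul, mul_comm n 2, ← ofReal_norm (r : ℂ),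
    Complex.norm_real, Real.norm_of_nonneg hr.1.le, ENNReal.ofReal_pow hr.1.le]

/-- Parseval's identity on the circle of radius `r`. -/
theorem HasTaylor.lintegral_angle {a : ℕ → ℂ} {g : ℂ → ℂ} (h : HasTaylor a g) {r : ℝ}
    (hr : r ∈ Ioo (0 : ℝ) 1) :
    ∫⁻ t, ‖g (polar r t)‖ₑ ^ 2 ∂angleMeasure
      = ∑' n, ‖a n‖ₑ ^ 2 * ENNReal.ofReal (r ^ (2 * n)) := by
  have h1 := h.lintegral_Ioc hr 0
  rw [zero_add] at h1
  have hp : (0 : ℝ) < 2 * Real.pi := by positivity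
  rw [angleMeasure, lintegral_smul_measure, h1, smul_eq_mul, ← mul_assoc,
    ← ENNReal.ofReal_mul (inv_nonneg.mpr hp.le), inv_mul_cancel₀ hp.ne', ENNReal.ofReal_one,
    one_mul]

theorem lintegral_areaMeasure_polar {F : ℂ → ℝ≥0∞} (hF : Measurable F) :
    ∫⁻ z, F z ∂areaMeasure = ENNReal.ofReal Real.pi⁻¹ *
      ∫⁻ r in Ioo (0 : ℝ) 1, ENNReal.ofReal r *
        ∫⁻ t in Ioc (-Real.pi) Real.pi, F (polar r t) := by
  have hd : MeasurableSet disc := isOpen_disc.measurableSet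
  have hpol : ∀ p : ℝ × ℝ, Complex.polarCoord.symm p = polar p.1 p.2 := fun p => by
    rw [Complex.polarCoord_symm_apply, polar, Complex.exp_mul_I, ← Complex.ofReal_cos,
      ← Complex.ofReal_sin]
  have hpm : Measurable fun p : ℝ × ℝ => polar p.1 p.2 := by
    unfold polar
    fun_prop
  have hm : Measurable fun p : ℝ × ℝ => ENNReal.ofReal p.1 * (disc.indicator F) (polar p.1 p.2) :=
    (measurable_fst.ennreal_ofReal).mul ((hF.indicator hd).comp hpm)
  rw [areaMeasure, lintegral_smul_measure, smul_eq_mul]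
  congr 1
  rw [← lintegral_indicator hd, ← Complex.lintegral_comp_polarCoord_symm]
  simp_rw [hpol, smul_eq_mul]
  rw [polarCoord_target, Measure.volume_eq_prod, ← Measure.prod_restrict,
    lintegral_prod _ hm.aemeasurable, ← lintegral_indicator measurableSet_Ioi,
    ← lintegral_indicator measurableSet_Ioo]
  congr 1
  ext r
  by_cases hr : 0 < r
  · rw [indicator_of_mem (show r ∈ Ioi (0 : ℝ) from hr)]
    simp only
    rw [lintegral_const_mul' _ _ ENNReal.ofReal_ne_top,
      restrict_Ioo_eq_restrict_Ioc (μ := (volume : Measure ℝ)) (a := -Real.pi) (b := Real.pi)]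
    by_cases hr1 : r < 1
    · rw [indicator_of_mem (show r ∈ Ioo (0 : ℝ) 1 from ⟨hr, hr1⟩)]
      simp_rw [indicator_of_mem (polar_mem_disc ⟨hr, hr1⟩ _)]
    · rw [indicator_of_notMem (show r ∉ Ioo (0 : ℝ) 1 from fun h => hr1 h.2)]
      have : ∀ t, polar r t ∉ disc := fun t ht => hr1 (by
        rwa [mem_disc, norm_polar hr.le] at ht)
      simp_rw [indicator_of_notMem (this _)]
      simp
  · rw [indicator_of_notMem (show r ∉ Ioi (0 : ℝ) from hr),
      indicator_of_notMem (show r ∉ Ioo (0 : ℝ) 1 from fun h => hr h.1)]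

theorem lintegral_pow_weight (n : ℕ) :
    ∫⁻ r in Ioo (0 : ℝ) 1, ENNReal.ofReal (r * (1 - r ^ 2) * r ^ (2 * n))
      = ENNReal.ofReal (1 / (2 * ((n + 1) * (n + 2)))) := by
  have hc : Continuous fun r : ℝ => r * (1 - r ^ 2) * r ^ (2 * n) := by fun_prop
  rw [restrict_Ioo_eq_restrict_Ioc, ← ofReal_integral_eq_lintegral_ofReal hc.integrableOn_Ioc]
  · rw [← intervalIntegral.integral_of_le zero_le_one]
    have : ∀ r : ℝ, r * (1 - r ^ 2) * r ^ (2 * n) = r ^ (2 * n + 1) - r ^ (2 * n + 3) :=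
      fun r => by ring
    simp_rw [this]
    rw [intervalIntegral.integral_sub (by simp) (by simp), integral_pow, integral_pow]
    congr 1
    push_cast
    simp only [one_pow, ne_eq, Nat.add_eq_zero_iff, one_ne_zero, and_false, not_false_eq_true,
      zero_pow, sub_zero, OfNat.ofNat_ne_zero]
    field_simp
    ring
  · filter_upwards [ae_restrict_mem measurableSet_Ioc] with r hr
    have h0 := hr.1
    have : r ^ 2 ≤ 1 := by nlinarith [hr.1, hr.2]
    have : 0 ≤ 1 - r ^ 2 := by linarith
    positivity

/-- Parseval's identity on the disc with the weight `1 - |z|²`. -/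
theorem HasTaylor.lintegral_area {a : ℕ → ℂ} {g : ℂ → ℂ} (h : HasTaylor a g)
    (hg : ContinuousOn g disc) :
    ∫⁻ z, ‖g z‖ₑ ^ 2 * ENNReal.ofReal (1 - ‖z‖ ^ 2) ∂areaMeasure
      = ∑' n, ‖a n‖ₑ ^ 2 * ENNReal.ofReal (1 / (((n : ℝ) + 1) * (n + 2))) := by
  have hd : MeasurableSet disc := isOpen_disc.measurableSet
  classical
  set G : ℂ → ℂ := disc.piecewise g 0
  have hGm : Measurable G := hg.measurable_piecewise continuousOn_const hd
  have hGg : ∀ z ∈ disc, G z = g z := fun z hz => piecewise_eq_of_mem _ _ _ hz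
  have hm : Measurable fun z => ‖G z‖ₑ ^ 2 * ENNReal.ofReal (1 - ‖z‖ ^ 2) := by fun_prop
  have h1 : ∫⁻ z, ‖g z‖ₑ ^ 2 * ENNReal.ofReal (1 - ‖z‖ ^ 2) ∂areaMeasure
      = ∫⁻ z, ‖G z‖ₑ ^ 2 * ENNReal.ofReal (1 - ‖z‖ ^ 2) ∂areaMeasure := by
    refine lintegral_congr_ae ?_
    refine Measure.ae_smul_measure ?_ _
    filter_upwards [ae_restrict_mem hd] with z hz
    rw [hGg z hz]
  rw [h1, lintegral_areaMeasure_polar hm]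
  have hlen : -Real.pi + 2 * Real.pi = Real.pi := by ring
  have h2 : ∀ r ∈ Ioo (0 : ℝ) 1, ENNReal.ofReal r * ∫⁻ t in Ioc (-Real.pi) Real.pi,
      ‖G (polar r t)‖ₑ ^ 2 * ENNReal.ofReal (1 - ‖polar r t‖ ^ 2)
        = ∑' n, ENNReal.ofReal (2 * Real.pi) * ‖a n‖ₑ ^ 2 *
          ENNReal.ofReal (r * (1 - r ^ 2) * r ^ (2 * n)) := fun r hr => by
    have h3 := h.lintegral_Ioc hr (-Real.pi)
    rw [hlen] at h3
    have hr2 : 0 ≤ 1 - r ^ 2 := by nlinarith [hr.1, hr.2]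
    simp_rw [hGg _ (polar_mem_disc hr _), norm_polar hr.1.le]
    rw [lintegral_mul_const' _ _ ENNReal.ofReal_ne_top, h3, ← ENNReal.tsum_mul_left,
      ← ENNReal.tsum_mul_right, ← ENNReal.tsum_mul_left]
    refine tsum_congr fun n => ?_
    rw [ENNReal.ofReal_mul (mul_nonneg hr.1.le hr2), ENNReal.ofReal_mul hr.1.le]
    ring
  rw [setLIntegral_congr_fun measurableSet_Ioo h2, lintegral_tsum (fun n => by fun_prop),
    ← ENNReal.tsum_mul_left]
  refine tsum_congr fun n => ?_
  rw [lintegral_const_mul _ (by fun_prop), lintegral_pow_weight]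
  have h4 : ENNReal.ofReal Real.pi⁻¹ * (ENNReal.ofReal (2 * Real.pi) * ‖a n‖ₑ ^ 2 *
      ENNReal.ofReal (1 / (2 * (((n : ℝ) + 1) * (n + 2)))))
      = ‖a n‖ₑ ^ 2 * (ENNReal.ofReal Real.pi⁻¹ * ENNReal.ofReal (2 * Real.pi) *
      ENNReal.ofReal (1 / (2 * (((n : ℝ) + 1) * (n + 2))))) := by ring
  have hpi := Real.pi_pos
  rw [h4, ← ENNReal.ofReal_mul (by positivity), ← ENNReal.ofReal_mul (by positivity)]
  congr 2
  field_simp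

/-! ### Taylor coefficients and Fejér means -/

/-- The `n`-th Taylor coefficient at the origin. -/
noncomputable def taylorCoeff (n : ℕ) (g : ℂ → ℂ) : ℂ := (n.factorial : ℂ)⁻¹ * iteratedDeriv n g 0

theorem hasTaylor_taylorCoeff {g : ℂ → ℂ} (hg : DifferentiableOn ℂ g disc) :
    HasTaylor (fun n => taylorCoeff n g) g := fun z hz => by
  have h := Complex.hasSum_taylorSeries_on_ball hg hz
  simp only [sub_zero, smul_eq_mul] at h
  have e : (fun n => taylorCoeff n g * z ^ n)
      = fun n => (n.factorial : ℂ)⁻¹ * (z ^ n * iteratedDeriv n g 0) := by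
    ext n
    rw [taylorCoeff]
    ring
  rw [e]
  exact h

/-- A power series expansion on the disc determines its coefficients. -/
theorem HasTaylor.unique {a b : ℕ → ℂ} {g : ℂ → ℂ} (ha : HasTaylor a g) (hb : HasTaylor b g) :
    a = b := by
  have key : ∀ c : ℕ → ℂ, HasTaylor c g →
      HasFPowerSeriesAt g (FormalMultilinearSeries.ofScalars ℂ c) 0 := fun c hc => by
    rw [hasFPowerSeriesAt_iff]
    filter_upwards [isOpen_disc.mem_nhds zero_mem_disc] with z hz
    simpa [FormalMultilinearSeries.coeff_ofScalars, mul_comm] using hc z hz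
  have h := (key a ha).eq_formalMultilinearSeries (key b hb)
  ext n
  simpa [FormalMultilinearSeries.coeff_ofScalars] using
    congrArg (fun p => FormalMultilinearSeries.coeff p n) h

theorem taylorCoeff_deriv (n : ℕ) (g : ℂ → ℂ) :
    taylorCoeff n (deriv g) = (n + 1) * taylorCoeff (n + 1) g := by
  have h : (n.factorial : ℂ) ≠ 0 := by exact_mod_cast n.factorial_ne_zero
  have h1 : (n : ℂ) + 1 ≠ 0 := by exact_mod_cast n.succ_ne_zero
  rw [taylorCoeff, taylorCoeff, iteratedDeriv_succ', Nat.factorial_succ]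
  push_cast
  field_simp

/-- The weight of the `n`-th Taylor coefficient in the `N`-th Fejér mean. -/
noncomputable def fejerWeight (N n : ℕ) : ℝ := if n < N then 1 - n / N else 0

/-- The `N`-th Fejér (Cesàro) mean of the Taylor series of `g` at the origin. -/
noncomputable def fejer (N : ℕ) (g : ℂ → ℂ) (z : ℂ) : ℂ :=
  ∑ n ∈ Finset.range N, fejerWeight N n * taylorCoeff n g * z ^ n

theorem fejerWeight_nonneg (N n : ℕ) : 0 ≤ fejerWeight N n := by
  unfold fejerWeight
  split_ifs with h
  · have : (n : ℝ) / N ≤ 1 := div_le_one_of_le₀ (by exact_mod_cast h.le) (by positivity)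
    linarith
  · exact le_rfl

theorem fejerWeight_le_one (N n : ℕ) : fejerWeight N n ≤ 1 := by
  unfold fejerWeight
  split_ifs with h
  · have : (0 : ℝ) ≤ n / N := by positivity
    linarith
  · exact zero_le_one

theorem tendsto_fejerWeight (n : ℕ) : Tendsto (fun N => fejerWeight N n) atTop (𝓝 1) := by
  have h : Tendsto (fun N : ℕ => 1 - (n : ℝ) / N) atTop (𝓝 (1 - 0)) :=
    tendsto_const_nhds.sub (tendsto_const_div_atTop_nhds_zero_nat _)
  rw [sub_zero] at h
  refine h.congr' ?_
  filter_upwards [eventually_gt_atTop n] with N hN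
  rw [fejerWeight, if_pos hN]

theorem differentiable_fejer (N : ℕ) (g : ℂ → ℂ) : Differentiable ℂ (fejer N g) := by
  unfold fejer
  fun_prop

theorem taylorCoeff_fejer (N n : ℕ) (g : ℂ → ℂ) :
    taylorCoeff n (fejer N g) = fejerWeight N n * taylorCoeff n g := by
  have h : HasTaylor (fun n => fejerWeight N n * taylorCoeff n g) (fejer N g) := fun z _ => by
    refine hasSum_sum_of_ne_finset_zero fun n hn => ?_
    rw [Finset.mem_range] at hn
    simp [fejerWeight, hn]
  exact congrFun ((hasTaylor_taylorCoeff (differentiable_fejer N g).differentiableOn).unique h) n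

theorem differentiableOn_iterate_deriv {g : ℂ → ℂ} (hg : DifferentiableOn ℂ g disc) (i : ℕ) :
    DifferentiableOn ℂ (deriv^[i] g) disc := by
  induction i with
  | zero => exact hg
  | succ i ih =>
    rw [Function.iterate_succ_apply']
    exact ih.deriv isOpen_disc

theorem taylorCoeff_iterate_deriv_fejer (N i n : ℕ) (g : ℂ → ℂ) :
    taylorCoeff n (deriv^[i] (fejer N g))
      = fejerWeight N (n + i) * taylorCoeff n (deriv^[i] g) := by
  induction i generalizing n with
  | zero => exact taylorCoeff_fejer N n g
  | succ i ih =>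
    rw [Function.iterate_succ_apply', Function.iterate_succ_apply', taylorCoeff_deriv,
      taylorCoeff_deriv, ih, show n + 1 + i = n + (i + 1) by ring]
    ring

theorem tendsto_iterate_deriv_fejer {g : ℂ → ℂ} (hg : DifferentiableOn ℂ g disc) (i : ℕ) {z : ℂ}
    (hz : z ∈ disc) :
    Tendsto (fun N => deriv^[i] (fejer N g) z) atTop (𝓝 (deriv^[i] g z)) := by
  have h1 := hasTaylor_taylorCoeff (differentiableOn_iterate_deriv hg i)
  have h2 := fun N => hasTaylor_taylorCoeff
    (differentiableOn_iterate_deriv (differentiable_fejer N g).differentiableOn i) z hz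
  rw [← (h1 z hz).tsum_eq]
  simp_rw [← fun N => (h2 N).tsum_eq]
  refine tendsto_tsum_of_dominated_convergence (h1.summable_norm hz) (fun n => ?_)
    (Eventually.of_forall fun N n => ?_)
  · simp_rw [taylorCoeff_iterate_deriv_fejer, mul_assoc]
    have h := (Complex.continuous_ofReal.tendsto 1).comp (tendsto_fejerWeight (n + i))
    simpa using h.mul_const (taylorCoeff n (deriv^[i] g) * z ^ n)
  · rw [taylorCoeff_iterate_deriv_fejer, mul_assoc, norm_mul, Complex.norm_real,
      Real.norm_of_nonneg (fejerWeight_nonneg _ _)]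
    exact mul_le_of_le_one_left (norm_nonneg _) (fejerWeight_le_one _ _)

/-! ### The contraction inequality for Fejér means of partial sums -/

/-- Partial sums of a series whose terms carry the Fejér weights, in terms of the partial sums of
the original series (Abel summation). -/
theorem sum_fejerWeight_mul {N : ℕ} (b : ℕ → ℂ) {n : ℕ} (hn : n ≤ N) :
    (N : ℂ) * ∑ k ∈ Finset.range n, fejerWeight N (k + 1) * b k
      = (N - n) * ∑ k ∈ Finset.range n, b k
        + ∑ k ∈ Finset.range n, ∑ l ∈ Finset.range k, b l := by
  induction n with
  | zero => simp
  | succ n ih =>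
    have hN : (N : ℂ) ≠ 0 := by
      have : N ≠ 0 := by omega
      exact_mod_cast this
    have hw : (fejerWeight N (n + 1) : ℂ) = 1 - (n + 1) / N := by
      unfold fejerWeight
      split_ifs with h
      · push_cast
        ring
      · have : n + 1 = N := by omega
        rw [← this]
        push_cast
        rw [div_self (by exact_mod_cast n.succ_ne_zero)]
        simp
    rw [Finset.sum_range_succ, Finset.sum_range_succ, Finset.sum_range_succ, mul_add,
      ih (by omega), hw]
    push_cast
    field_simp
    ring

theorem sum_fejerWeight_mul_of_le {N : ℕ} (b : ℕ → ℂ) {n : ℕ} (hn : N ≤ n) :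
    ∑ k ∈ Finset.range n, fejerWeight N (k + 1) * b k
      = ∑ k ∈ Finset.range N, fejerWeight N (k + 1) * b k := by
  refine (Finset.sum_subset (Finset.range_subset_range.mpr hn) fun k _ hk => ?_).symm
  rw [Finset.mem_range] at hk
  rw [fejerWeight, if_neg (by omega)]
  simp

/-- With `d = A / (n + 1)`, the vector on the right is the convex combination of `x` and `d` with
weights `1 - s (n + 1)` and `s (n + 1)`, and `(A + x) / (n + 2)` is the one with weights
`1 / (n + 2)` and `(n + 1) / (n + 2)`. -/
theorem fejer_step (n s : ℝ) (hn : 0 ≤ n) (hs : 0 ≤ s) (hsn : s * (n + 1) ≤ 1) (x A : ℂ) :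
    s * ‖(A + x) / (n + 2)‖ ^ 2 - s * ‖A / (n + 1)‖ ^ 2 ≤
      (‖x‖ ^ 2 - ‖(1 - s * (n + 1)) * x + s * A‖ ^ 2) / ((n + 1) * (n + 2)) := by
  obtain ⟨d, rfl⟩ : ∃ d : ℂ, A = (n + 1) * d := ⟨A / (n + 1), by
    have : (n : ℂ) + 1 ≠ 0 := by
      norm_cast
      positivity
    field_simp⟩
  have h1 : (n + 1) * d / ((n : ℂ) + 1) = d := by
    have : (n : ℂ) + 1 ≠ 0 := by
      norm_cast
      positivity
    field_simp
  have h2 : ‖((n + 1) * d + x) / ((n : ℂ) + 2)‖ ^ 2 = ‖(n + 1) * d + x‖ ^ 2 / (n + 2) ^ 2 := by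
    rw [norm_div, div_pow]
    congr 2
    rw [show (n : ℂ) + 2 = ((n + 2 : ℝ) : ℂ) by push_cast; ring, Complex.norm_real,
      Real.norm_of_nonneg (by positivity)]
  rw [h1, h2]
  have e : ∀ w : ℂ, ‖w‖ ^ 2 = w.re ^ 2 + w.im ^ 2 := fun w => by
    rw [← Complex.normSq_eq_norm_sq, Complex.normSq_apply]
    ring
  -- The difference of the two sides is a nonnegative multiple of `‖x - d‖ ^ 2`.
  have key : (‖x‖ ^ 2 - ‖(1 - s * (n + 1)) * x + s * ((n + 1) * d)‖ ^ 2) / ((n + 1) * (n + 2))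
      - (s * (‖(n + 1) * d + x‖ ^ 2 / (n + 2) ^ 2) - s * ‖d‖ ^ 2)
      = s / (n + 2) * ‖x - d‖ ^ 2 * ((1 - s * (n + 1)) + (n + 1) / (n + 2)) := by
    simp only [e, Complex.add_re, Complex.add_im, Complex.sub_re, Complex.sub_im, Complex.mul_re,
      Complex.mul_im, Complex.ofReal_re, Complex.ofReal_im, Complex.one_re, Complex.one_im]
    field_simp
    ring
  have h3 : 0 ≤ s / (n + 2) * ‖x - d‖ ^ 2 * ((1 - s * (n + 1)) + (n + 1) / (n + 2)) := by
    have : 0 ≤ 1 - s * (n + 1) := by linarith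
    positivity
  linarith

/-- Below the order `N` of the mean, the gain in passing to the Fejér mean controls the mean of the
partial sums. -/
theorem fejer_gain_of_lt {N : ℕ} (b : ℕ → ℂ) {M : ℕ} (hM : M + 1 ≤ N) :
    (N : ℝ)⁻¹ * ‖(∑ k ∈ Finset.range (M + 1), ∑ l ∈ Finset.range k, b l) / ((M : ℝ) + 1)‖ ^ 2 ≤
      ∑ n ∈ Finset.range M, (‖∑ k ∈ Finset.range (n + 1), b k‖ ^ 2
        - ‖∑ k ∈ Finset.range (n + 1), fejerWeight N (k + 1) * b k‖ ^ 2)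
          / (((n : ℝ) + 1) * (n + 2)) := by
  induction M with
  | zero => simp
  | succ M ih =>
    have hN : (0 : ℝ) < N := by
      have : 0 < N := by omega
      exact_mod_cast this
    have hNc : (N : ℂ) ≠ 0 := by exact_mod_cast hN.ne'
    have h1 := fejer_step M (N : ℝ)⁻¹ (by positivity) (by positivity) (by
      rw [inv_mul_le_iff₀ hN, mul_one]
      exact_mod_cast (by omega : M + 1 ≤ N)) (∑ k ∈ Finset.range (M + 1), b k)
      (∑ k ∈ Finset.range (M + 1), ∑ l ∈ Finset.range k, b l)
    have h2 : (1 - ((N : ℝ)⁻¹ : ℝ) * (((M : ℝ) : ℂ) + 1)) * ∑ k ∈ Finset.range (M + 1), b k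
        + ((N : ℝ)⁻¹ : ℝ) * ∑ k ∈ Finset.range (M + 1), ∑ l ∈ Finset.range k, b l
        = ∑ k ∈ Finset.range (M + 1), fejerWeight N (k + 1) * b k := by
      have h3 := sum_fejerWeight_mul b (n := M + 1) (N := N) (by omega)
      refine mul_left_cancel₀ hNc ?_
      rw [h3]
      push_cast
      field_simp
    rw [h2] at h1
    rw [Finset.sum_range_succ (fun k => ∑ l ∈ Finset.range k, b l) (M + 1),
      Finset.sum_range_succ (fun n => (_ : ℝ) / _) M]
    have h4 := ih (by omega)
    have h5 : (((M + 1 : ℕ) : ℝ) : ℂ) + 1 = ((M : ℝ) : ℂ) + 2 := by push_cast; ring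
    rw [h5]
    linarith

/-- From the order `N` of the mean on, the gain in passing to the Fejér mean pays for the remaining
terms, in which the partial sums of the Fejér mean are constant. -/
theorem fejer_gain_of_le {N : ℕ} (hN : 0 < N) (b : ℕ → ℂ) {M : ℕ} (hM : N ≤ M + 1) :
    ‖∑ k ∈ Finset.range N, fejerWeight N (k + 1) * b k‖ ^ 2 / ((M : ℝ) + 1) ≤
      ∑ n ∈ Finset.range M, (‖∑ k ∈ Finset.range (n + 1), b k‖ ^ 2
        - ‖∑ k ∈ Finset.range (n + 1), fejerWeight N (k + 1) * b k‖ ^ 2)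
          / (((n : ℝ) + 1) * (n + 2)) := by
  obtain ⟨L, rfl⟩ : ∃ L, N = L + 1 := ⟨N - 1, by omega⟩
  induction M, (by omega : L ≤ M) using Nat.le_induction with
  | base =>
    refine le_trans (le_of_eq ?_) (fejer_gain_of_lt b le_rfl)
    have h := sum_fejerWeight_mul b (le_refl (L + 1))
    rw [sub_self, zero_mul, zero_add] at h
    have hL : (((L + 1 : ℕ) : ℂ)) ≠ 0 := by exact_mod_cast L.succ_ne_zero
    rw [← h]
    push_cast at hL ⊢
    rw [mul_div_cancel_left₀ _ hL, div_eq_inv_mul]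
  | succ M hLM ih =>
    rw [Finset.sum_range_succ _ M,
      sum_fejerWeight_mul_of_le (N := L + 1) b (n := M + 1) (by omega)]
    have h1 := ih (by omega)
    set x := ‖∑ k ∈ Finset.range (L + 1), fejerWeight (L + 1) (k + 1) * b k‖ ^ 2
    have h2 : x / (((M + 1 : ℕ) : ℝ) + 1) = x / ((M : ℝ) + 1) - x / (((M : ℝ) + 1) * (M + 2)) := by
      push_cast
      field_simp
      ring
    have h3 : 0 ≤ ‖∑ k ∈ Finset.range (M + 1), b k‖ ^ 2 / (((M : ℝ) + 1) * (M + 2)) := by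
      positivity
    rw [h2, sub_div]
    linarith

/-- Fejér means contract the quadratic form `∑ ‖B (n + 1)‖ ^ 2 / ((n + 1) (n + 2))` of the partial
sums `B n` of a series. -/
theorem tsum_fejerWeight_le {N : ℕ} (hN : 0 < N) (b : ℕ → ℂ) :
    ∑' n : ℕ, ‖∑ k ∈ Finset.range (n + 1), fejerWeight N (k + 1) * b k‖ₑ ^ 2
        * ENNReal.ofReal (1 / (((n : ℝ) + 1) * (n + 2))) ≤
      ∑' n : ℕ, ‖∑ k ∈ Finset.range (n + 1), b k‖ₑ ^ 2
        * ENNReal.ofReal (1 / (((n : ℝ) + 1) * (n + 2))) := by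
  have e : ∀ (w : ℂ) (n : ℕ), ‖w‖ₑ ^ 2 * ENNReal.ofReal (1 / (((n : ℝ) + 1) * (n + 2)))
      = ENNReal.ofReal (‖w‖ ^ 2 / (((n : ℝ) + 1) * (n + 2))) := fun w n => by
    rw [← ofReal_norm, ← ENNReal.ofReal_pow (norm_nonneg _),
      ← ENNReal.ofReal_mul (by positivity), mul_one_div]
  refine ENNReal.tsum_le_of_sum_range_le fun M => le_trans ?_ (ENNReal.sum_le_tsum (Finset.range M))
  simp_rw [e]
  rw [← ENNReal.ofReal_sum_of_nonneg fun n _ => by positivity,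
    ← ENNReal.ofReal_sum_of_nonneg fun n _ => by positivity]
  refine ENNReal.ofReal_le_ofReal ?_
  rw [← sub_nonneg, ← Finset.sum_sub_distrib]
  simp_rw [← sub_div]
  rcases le_total N (M + 1) with h | h
  · exact le_trans (by positivity) (fejer_gain_of_le hN b h)
  · exact le_trans (by positivity) (fejer_gain_of_lt b h)

/-! ### Local Dirichlet integrals -/

theorem poissonKernel_eq_mul (z : ℂ) (ξ : UnitCircle) :
    poissonKernel 0 z (ξ : ℂ)
      = ‖(1 - (starRingEnd ℂ) (ξ : ℂ) * z)⁻¹‖ ^ 2 * (1 - ‖z‖ ^ 2) := by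
  have hξ : ‖(ξ : ℂ)‖ = 1 := norm_eq_of_mem_sphere ξ
  have h : (ξ : ℂ) - z = ξ * (1 - (starRingEnd ℂ) (ξ : ℂ) * z) := by
    rw [mul_sub, ← mul_assoc, Complex.mul_conj', hξ]
    simp
  rw [poissonKernel_circle, h, norm_mul, hξ, one_mul, norm_inv, inv_pow]
  ring

theorem one_sub_conj_mul_ne_zero (ξ : UnitCircle) {z : ℂ} (hz : z ∈ disc) :
    1 - (starRingEnd ℂ) (ξ : ℂ) * z ≠ 0 := fun h => by
  have hξ : ‖(ξ : ℂ)‖ = 1 := norm_eq_of_mem_sphere ξ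
  have h1 : ‖(starRingEnd ℂ) (ξ : ℂ) * z‖ = 1 := by rw [← sub_eq_zero.mp h, norm_one]
  rw [norm_mul, RCLike.norm_conj, hξ, one_mul] at h1
  exact absurd (mem_disc.mp hz) (by rw [h1]; exact lt_irrefl _)

/-- Division by `1 - conj ξ * z` replaces Taylor coefficients by twisted partial sums. -/
theorem HasTaylor.div_one_sub {a : ℕ → ℂ} {g : ℂ → ℂ} (h : HasTaylor a g) (ξ : UnitCircle) :
    HasTaylor (fun n => ∑ k ∈ Finset.range (n + 1), a k * (starRingEnd ℂ) (ξ : ℂ) ^ (n - k))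
      (fun z => g z * (1 - (starRingEnd ℂ) (ξ : ℂ) * z)⁻¹) := fun z hz => by
  have hξ : ‖(ξ : ℂ)‖ = 1 := norm_eq_of_mem_sphere ξ
  have hlt : ‖(starRingEnd ℂ) (ξ : ℂ) * z‖ < 1 := by
    rw [norm_mul, RCLike.norm_conj, hξ, one_mul]
    exact mem_disc.mp hz
  have h1 := h.summable_norm hz
  have h2 := summable_norm_geometric_of_norm_lt_one hlt
  have h3 := (summable_norm_sum_mul_range_of_summable_norm h1 h2).of_norm.hasSum
  rw [← tsum_mul_tsum_eq_tsum_sum_range_of_summable_norm h1 h2, (h z hz).tsum_eq,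
    tsum_geometric_of_norm_lt_one hlt] at h3
  refine Eq.subst (motive := fun f => HasSum f _) (funext fun n => ?_) h3
  symm
  rw [Finset.sum_mul]
  refine Finset.sum_congr rfl fun k hk => ?_
  rw [mul_pow, show z ^ n = z ^ k * z ^ (n - k) by
    rw [← pow_add, Nat.add_sub_cancel' (Finset.mem_range_succ_iff.mp hk)]]
  ring

/-- The Dirichlet integral of `g` at the boundary point `ξ` in terms of the Taylor coefficients. It
rests on `‖g'‖² P_ξ = ‖g' / (1 - conj ξ * z)‖² (1 - ‖z‖²)` and Parseval's identity. -/
theorem lintegral_deriv_mul_poissonKernel (ξ : UnitCircle) {g : ℂ → ℂ}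
    (hg : DifferentiableOn ℂ g disc) :
    ∫⁻ z, ‖deriv g z‖ₑ ^ 2 * ENNReal.ofReal (poissonKernel 0 z (ξ : ℂ)) ∂areaMeasure
      = ∑' n : ℕ, ‖∑ k ∈ Finset.range (n + 1),
          ((k : ℂ) + 1) * taylorCoeff (k + 1) g * (ξ : ℂ) ^ (k + 1)‖ₑ ^ 2
            * ENNReal.ofReal (1 / (((n : ℝ) + 1) * (n + 2))) := by
  have hg' : DifferentiableOn ℂ (deriv g) disc := hg.deriv isOpen_disc
  have hT := (hasTaylor_taylorCoeff hg').div_one_sub ξ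
  have hc : ContinuousOn (fun z => deriv g z * (1 - (starRingEnd ℂ) (ξ : ℂ) * z)⁻¹) disc :=
    hg'.continuousOn.mul (ContinuousOn.inv₀ (by fun_prop) fun z hz =>
      one_sub_conj_mul_ne_zero ξ hz)
  have hξ : ‖(ξ : ℂ)‖ = 1 := norm_eq_of_mem_sphere ξ
  rw [lintegral_congr fun z => ?_, hT.lintegral_area hc]
  · refine tsum_congr fun n => ?_
    congr 2
    have h1 : ∑ k ∈ Finset.range (n + 1),
          ((k : ℂ) + 1) * taylorCoeff (k + 1) g * (ξ : ℂ) ^ (k + 1)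
        = (ξ : ℂ) ^ (n + 1) * ∑ k ∈ Finset.range (n + 1),
          taylorCoeff k (deriv g) * (starRingEnd ℂ) (ξ : ℂ) ^ (n - k) := by
      rw [Finset.mul_sum]
      refine Finset.sum_congr rfl fun k hk => ?_
      have h2 : (ξ : ℂ) ^ (n + 1) = (ξ : ℂ) ^ (k + 1) * (ξ : ℂ) ^ (n - k) := by
        rw [← pow_add]
        congr 1
        have := Finset.mem_range_succ_iff.mp hk
        omega
      have h3 : (ξ : ℂ) ^ (n - k) * (starRingEnd ℂ) (ξ : ℂ) ^ (n - k) = 1 := by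
        rw [← mul_pow, Complex.mul_conj', hξ]
        simp
      rw [taylorCoeff_deriv, h2]
      linear_combination (-((k : ℂ) + 1) * taylorCoeff (k + 1) g * (ξ : ℂ) ^ (k + 1)) * h3
    rw [h1, enorm_mul, enorm_pow, ← ofReal_norm (ξ : ℂ), hξ]
    simp
  · rw [poissonKernel_eq_mul, ENNReal.ofReal_mul (by positivity),
      ENNReal.ofReal_pow (norm_nonneg _), ofReal_norm, enorm_mul, mul_pow, mul_assoc]

theorem lintegral_deriv_fejer_mul_poissonKernel_le (ξ : UnitCircle) {g : ℂ → ℂ}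
    (hg : DifferentiableOn ℂ g disc) {N : ℕ} (hN : 0 < N) :
    ∫⁻ z, ‖deriv (fejer N g) z‖ₑ ^ 2 * ENNReal.ofReal (poissonKernel 0 z (ξ : ℂ)) ∂areaMeasure
      ≤ ∫⁻ z, ‖deriv g z‖ₑ ^ 2 * ENNReal.ofReal (poissonKernel 0 z (ξ : ℂ)) ∂areaMeasure := by
  rw [lintegral_deriv_mul_poissonKernel ξ hg,
    lintegral_deriv_mul_poissonKernel ξ (differentiable_fejer N g).differentiableOn]
  refine le_trans (le_of_eq (tsum_congr fun n => ?_))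
    (tsum_fejerWeight_le hN fun k => ((k : ℂ) + 1) * taylorCoeff (k + 1) g * (ξ : ℂ) ^ (k + 1))
  congr 3
  refine Finset.sum_congr rfl fun k _ => ?_
  rw [taylorCoeff_fejer]
  ring

/-! ### The two kinds of measures on the disc -/

theorem measurable_poissonKernel :
    Measurable fun p : ℂ × UnitCircle => ENNReal.ofReal (poissonKernel 0 p.1 (p.2 : ℂ)) := by
  simp_rw [poissonKernel_circle]
  fun_prop

theorem measurable_poissonIntegral (μ : Measure UnitCircle) [IsFiniteMeasure μ] :
    Measurable (poissonIntegral μ) :=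
  (measurable_poissonKernel.lintegral_prod_right').const_mul _

/-- Normalized arc length measure on the circle of radius `r` about the origin. -/
noncomputable def circleMeasure (r : ℝ) : Measure ℂ := angleMeasure.map (polar r)

/-- The measure on the disc whose density with respect to area is the Poisson integral of `μ`. -/
noncomputable def poissonMeasure (μ : Measure UnitCircle) : Measure ℂ :=
  areaMeasure.withDensity (poissonIntegral μ)

instance (r : ℝ) : IsProbabilityMeasure (circleMeasure r) :=
  Measure.isProbabilityMeasure_map (continuous_polar r).aemeasurable

instance (μ : Measure UnitCircle) : SFinite (poissonMeasure μ) := by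
  unfold poissonMeasure
  infer_instance

theorem ae_mem_disc_areaMeasure : ∀ᵐ z ∂areaMeasure, z ∈ disc :=
  Measure.ae_smul_measure (ae_restrict_mem isOpen_disc.measurableSet) _

theorem ae_mem_disc_poissonMeasure (μ : Measure UnitCircle) : ∀ᵐ z ∂poissonMeasure μ, z ∈ disc :=
  (withDensity_absolutelyContinuous _ _).ae_le ae_mem_disc_areaMeasure

theorem ae_mem_disc_circleMeasure {r : ℝ} (hr : r ∈ Ioo (0 : ℝ) 1) :
    ∀ᵐ z ∂circleMeasure r, z ∈ disc := by
  rw [circleMeasure, ae_map_iff (p := fun z => z ∈ disc) (continuous_polar r).aemeasurable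
    isOpen_disc.measurableSet]
  exact ae_of_all _ fun t => polar_mem_disc hr t

theorem ContinuousOn.aemeasurable_of_ae_mem {X Y : Type*} [TopologicalSpace X] [MeasurableSpace X]
    [BorelSpace X] [TopologicalSpace Y] [MeasurableSpace Y] [BorelSpace Y] {s : Set X} {g : X → Y}
    (hg : ContinuousOn g s) (hs : IsOpen s) {m : Measure X} (hm : ∀ᵐ x ∂m, x ∈ s) :
    AEMeasurable g m := by
  have h := hg.aemeasurable (μ := m) hs.measurableSet
  rwa [Measure.restrict_eq_self_of_ae_mem hm] at h

theorem lintegral_circleMeasure {r : ℝ} (hr : r ∈ Ioo (0 : ℝ) 1) {g : ℂ → ℂ}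
    (hg : DifferentiableOn ℂ g disc) :
    ∫⁻ z, ‖g z‖ₑ ^ 2 ∂circleMeasure r
      = ∑' n, ‖taylorCoeff n g‖ₑ ^ 2 * ENNReal.ofReal (r ^ (2 * n)) := by
  have h := ContinuousOn.aemeasurable_of_ae_mem hg.continuousOn isOpen_disc
    (ae_mem_disc_circleMeasure hr)
  rw [← (hasTaylor_taylorCoeff hg).lintegral_angle hr]
  exact lintegral_map' (h.enorm.pow_const 2) (continuous_polar r).aemeasurable

theorem lintegral_poissonMeasure (μ : Measure UnitCircle) [IsFiniteMeasure μ] {F : ℂ → ℝ≥0∞}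
    (hF : Measurable F) :
    ∫⁻ z, F z ∂poissonMeasure μ = ENNReal.ofReal (2 * Real.pi)⁻¹ *
      ∫⁻ ξ, ∫⁻ z, F z * ENNReal.ofReal (poissonKernel 0 z (ξ : ℂ)) ∂areaMeasure ∂μ := by
  have hk : ∀ z : ℂ, Measurable fun ξ : UnitCircle =>
      ENNReal.ofReal (poissonKernel 0 z (ξ : ℂ)) := fun z => by
    simp_rw [poissonKernel_circle]
    fun_prop
  have hm : Measurable (Function.uncurry fun (z : ℂ) (ξ : UnitCircle) =>
      F z * ENNReal.ofReal (poissonKernel 0 z (ξ : ℂ))) := by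
    have h : Measurable fun p : ℂ × UnitCircle => F p.1 := hF.comp measurable_fst
    exact h.mul measurable_poissonKernel
  have h1 := lintegral_lintegral_swap (μ := areaMeasure) (ν := μ) hm.aemeasurable
  have h2 : Measurable fun z : ℂ =>
      ∫⁻ ξ : UnitCircle, F z * ENNReal.ofReal (poissonKernel 0 z (ξ : ℂ)) ∂μ :=
    hm.lintegral_prod_right'
  have h3 : ∫⁻ z, F z ∂poissonMeasure μ = ∫⁻ z, (poissonIntegral μ * F) z ∂areaMeasure :=
    lintegral_withDensity_eq_lintegral_mul _ (measurable_poissonIntegral μ) hF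
  rw [h3, ← h1, ← lintegral_const_mul _ h2]
  refine lintegral_congr fun z => ?_
  rw [lintegral_const_mul _ (hk z), Pi.mul_apply, poissonIntegral]
  ring

/-- A family of measures `α r` on the disc, to be integrated against the square of the modulus of an
`i`-th derivative, for which these integrals increase with `r` and decrease under the passage to
Fejér means. The two families of interest are circles of radius `r`, with `i = 0`, and the constant
family of the area measure weighted by a Poisson integral, with `i = 1`. -/
structure Admissible (i : ℕ) (α : ℝ → Measure ℂ) : Prop where
  sFinite : ∀ r : ℝ, SFinite (α r)
  ae_mem : ∀ r ∈ Ioo (0 : ℝ) 1, ∀ᵐ z ∂α r, z ∈ disc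
  mono : ∀ g : ℂ → ℂ, DifferentiableOn ℂ g disc → ∀ r ∈ Ioo (0 : ℝ) 1, ∀ s ∈ Ioo (0 : ℝ) 1, r ≤ s →
    ∫⁻ z, ‖deriv^[i] g z‖ₑ ^ 2 ∂α r ≤ ∫⁻ z, ‖deriv^[i] g z‖ₑ ^ 2 ∂α s
  fejer_le : ∀ g : ℂ → ℂ, DifferentiableOn ℂ g disc → ∀ r ∈ Ioo (0 : ℝ) 1, ∀ N : ℕ, 0 < N →
    ∫⁻ z, ‖deriv^[i] (fejer N g) z‖ₑ ^ 2 ∂α r ≤ ∫⁻ z, ‖deriv^[i] g z‖ₑ ^ 2 ∂α r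

theorem admissible_circleMeasure : Admissible 0 circleMeasure where
  sFinite _ := inferInstance
  ae_mem _ hr := ae_mem_disc_circleMeasure hr
  mono g hg r hr s hs hrs := by
    simp only [Function.iterate_zero, id_eq]
    rw [lintegral_circleMeasure hr hg, lintegral_circleMeasure hs hg]
    refine ENNReal.tsum_le_tsum fun n => mul_le_mul_right (ENNReal.ofReal_le_ofReal ?_) _
    exact pow_le_pow_left₀ hr.1.le hrs _
  fejer_le g hg r hr N _ := by
    simp only [Function.iterate_zero, id_eq]
    rw [lintegral_circleMeasure hr hg,
      lintegral_circleMeasure hr (differentiable_fejer N g).differentiableOn]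
    refine ENNReal.tsum_le_tsum fun n => mul_le_mul_left ?_ _
    rw [taylorCoeff_fejer, enorm_mul, mul_pow]
    refine mul_le_of_le_one_left' (pow_le_one' ?_ 2)
    rw [← ofReal_norm, Complex.norm_real, Real.norm_of_nonneg (fejerWeight_nonneg _ _),
      ENNReal.ofReal_le_one]
    exact fejerWeight_le_one _ _

theorem admissible_poissonMeasure (μ : Measure UnitCircle) [IsFiniteMeasure μ] :
    Admissible 1 fun _ => poissonMeasure μ where
  sFinite _ := inferInstance
  ae_mem _ _ := ae_mem_disc_poissonMeasure μ
  mono _ _ _ _ _ _ _ := le_rfl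
  fejer_le g hg r _ N hN := by
    simp only [Function.iterate_one]
    rw [lintegral_poissonMeasure μ ((measurable_deriv _).enorm.pow_const 2),
      lintegral_poissonMeasure μ ((measurable_deriv _).enorm.pow_const 2)]
    exact mul_le_mul_right
      (lintegral_mono fun ξ => lintegral_deriv_fejer_mul_poissonKernel_le ξ hg hN) _

theorem tsum_one_div_mul_succ :
    ∑' n : ℕ, ENNReal.ofReal (1 / (((n : ℝ) + 1) * (n + 2))) ≤ 1 := by
  refine ENNReal.tsum_le_of_sum_range_le fun M => ?_
  rw [← ENNReal.ofReal_sum_of_nonneg fun n _ => by positivity, ENNReal.ofReal_le_one]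
  have h : ∑ n ∈ Finset.range M, 1 / (((n : ℝ) + 1) * (n + 2)) = 1 - 1 / ((M : ℝ) + 1) := by
    induction M with
    | zero => simp
    | succ M ih =>
      rw [Finset.sum_range_succ, ih]
      push_cast
      field_simp
      ring
  rw [h]
  have : (0 : ℝ) ≤ 1 / ((M : ℝ) + 1) := by positivity
  linarith

/-- The mass is the Dirichlet integral of the function `z`. -/
instance isFiniteMeasure_poissonMeasure (μ : Measure UnitCircle) [IsFiniteMeasure μ] :
    IsFiniteMeasure (poissonMeasure μ) := by
  refine ⟨?_⟩
  rw [← lintegral_one, lintegral_poissonMeasure μ measurable_const]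
  have h : ∀ ξ : UnitCircle, ∫⁻ z, 1 * ENNReal.ofReal (poissonKernel 0 z (ξ : ℂ)) ∂areaMeasure
      ≤ 1 := fun ξ => by
    have h1 := lintegral_deriv_mul_poissonKernel ξ (g := id) differentiableOn_id
    simp only [deriv_id, enorm_one, one_pow] at h1
    rw [h1]
    refine le_trans (ENNReal.tsum_le_tsum fun n => ?_) tsum_one_div_mul_succ
    have hξ : ‖(ξ : ℂ)‖ = 1 := norm_eq_of_mem_sphere ξ
    have hc : ∀ k, taylorCoeff (k + 1) id * ((k : ℂ) + 1) = if k = 0 then 1 else 0 := fun k => by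
      have hT : HasTaylor (fun n => if n = 1 then 1 else 0) id := fun z _ => by
        have := hasSum_ite_eq (1 : ℕ) z
        refine Eq.subst (motive := fun f => HasSum f _) (funext fun n => ?_) this
        by_cases hn : n = 1 <;> simp [hn]
      have h2 := congrFun ((hasTaylor_taylorCoeff (g := id) differentiableOn_id).unique hT) (k + 1)
      rw [show taylorCoeff (k + 1) id = if k + 1 = 1 then 1 else 0 from h2]
      by_cases hk : k = 0 <;> simp [hk]
    have h3 : ∑ k ∈ Finset.range (n + 1),
        ((k : ℂ) + 1) * taylorCoeff (k + 1) id * (ξ : ℂ) ^ (k + 1) = ξ := by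
      rw [Finset.sum_eq_single 0]
      · rw [mul_comm ((0 : ℕ) + 1 : ℂ), hc]
        simp
      · intro k _ hk
        rw [mul_comm ((k : ℂ) + 1), hc]
        simp [hk]
      · simp
    rw [h3, ← ofReal_norm, hξ]
    simp
  refine ENNReal.mul_lt_top ENNReal.ofReal_lt_top (lt_of_le_of_lt (lintegral_mono h) ?_)
  rw [lintegral_one]
  exact measure_lt_top μ _

/-! ### Comparison of the Hardy norm with the Dirichlet integral in one variable -/

theorem enorm_zero_le_lintegral_circleMeasure {r : ℝ} (hr : r ∈ Ioo (0 : ℝ) 1) {g : ℂ → ℂ}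
    (hg : DifferentiableOn ℂ g disc) : ‖g 0‖ₑ ^ 2 ≤ ∫⁻ z, ‖g z‖ₑ ^ 2 ∂circleMeasure r := by
  rw [lintegral_circleMeasure hr hg]
  refine le_trans (le_of_eq ?_) (ENNReal.le_tsum 0)
  simp [taylorCoeff]

theorem lintegral_circleMeasure_le_area {r : ℝ} (hr : r ∈ Ioo (0 : ℝ) 1) {g : ℂ → ℂ}
    (hg : DifferentiableOn ℂ g disc) :
    ∫⁻ z, ‖g z‖ₑ ^ 2 ∂circleMeasure r ≤ ‖g 0‖ₑ ^ 2 +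
      2 * ∫⁻ z, ‖deriv g z‖ₑ ^ 2 * ENNReal.ofReal (1 - ‖z‖ ^ 2) ∂areaMeasure := by
  have hg' : DifferentiableOn ℂ (deriv g) disc := hg.deriv isOpen_disc
  rw [lintegral_circleMeasure hr hg, (hasTaylor_taylorCoeff hg').lintegral_area hg'.continuousOn,
    tsum_eq_zero_add' ENNReal.summable, ← ENNReal.tsum_mul_left]
  refine add_le_add (le_of_eq (by simp [taylorCoeff])) (ENNReal.tsum_le_tsum fun n => ?_)
  have h1 : ENNReal.ofReal (r ^ (2 * (n + 1))) ≤ 1 := by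
    rw [ENNReal.ofReal_le_one]
    exact pow_le_one₀ hr.1.le hr.2.le
  refine le_trans (mul_le_of_le_one_right' h1) ?_
  have h2 : ‖taylorCoeff n (deriv g)‖ₑ ^ 2
      = ENNReal.ofReal (((n : ℝ) + 1) ^ 2) * ‖taylorCoeff (n + 1) g‖ₑ ^ 2 := by
    rw [taylorCoeff_deriv, enorm_mul, mul_pow, ENNReal.ofReal_pow (by positivity), ← ofReal_norm]
    congr 3
    rw [show (n : ℂ) + 1 = ((n + 1 : ℝ) : ℂ) by push_cast; ring, Complex.norm_real,
      Real.norm_of_nonneg (by positivity)]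
  have h3 : 1 ≤ ENNReal.ofReal 2 * (ENNReal.ofReal (((n : ℝ) + 1) ^ 2)
      * ENNReal.ofReal (1 / (((n : ℝ) + 1) * (n + 2)))) := by
    rw [← ENNReal.ofReal_mul (by positivity), ← ENNReal.ofReal_mul (by positivity),
      ENNReal.one_le_ofReal]
    have : (0 : ℝ) ≤ n := n.cast_nonneg
    rw [mul_one_div, ← mul_div_assoc, le_div_iff₀ (by positivity)]
    nlinarith
  rw [h2]
  calc ‖taylorCoeff (n + 1) g‖ₑ ^ 2
      ≤ ‖taylorCoeff (n + 1) g‖ₑ ^ 2 * (ENNReal.ofReal 2 * (ENNReal.ofReal (((n : ℝ) + 1) ^ 2)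
      * ENNReal.ofReal (1 / (((n : ℝ) + 1) * (n + 2))))) := le_mul_of_one_le_right' h3
    _ = _ := by
      rw [ENNReal.ofReal_ofNat]
      ring

/-- The mean square on circles is controlled by the value at the origin and the Dirichlet integral
with respect to a nonzero measure. -/
theorem exists_lintegral_circleMeasure_le (μ : Measure UnitCircle) [IsFiniteMeasure μ]
    (hμ : μ ≠ 0) : ∃ C : ℝ≥0∞, C ≠ ∞ ∧ ∀ r ∈ Ioo (0 : ℝ) 1, ∀ g : ℂ → ℂ,
      DifferentiableOn ℂ g disc → ∫⁻ z, ‖g z‖ₑ ^ 2 ∂circleMeasure r ≤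
        ‖g 0‖ₑ ^ 2 + C * ∫⁻ z, ‖deriv g z‖ₑ ^ 2 ∂poissonMeasure μ := by
  -- As `|ξ - z| ≤ 2`, the Poisson kernel is at least `(1 - |z|²) / 4`.
  set c : ℝ≥0∞ := ENNReal.ofReal (2 * Real.pi)⁻¹ * (ENNReal.ofReal (1 / 4) * μ univ) with hc
  have hc0 : c ≠ 0 := by
    have h1 : ENNReal.ofReal (2 * Real.pi)⁻¹ ≠ 0 := by
      rw [ne_eq, ENNReal.ofReal_eq_zero, not_le]
      have := Real.pi_pos
      positivity
    have h2 : ENNReal.ofReal (1 / 4) ≠ 0 := by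
      rw [ne_eq, ENNReal.ofReal_eq_zero, not_le]
      norm_num
    have h3 : μ univ ≠ 0 := by rwa [ne_eq, Measure.measure_univ_eq_zero]
    exact mul_ne_zero h1 (mul_ne_zero h2 h3)
  have hct : c ≠ ∞ := ENNReal.mul_ne_top ENNReal.ofReal_ne_top
    (ENNReal.mul_ne_top ENNReal.ofReal_ne_top (measure_ne_top μ _))
  have hP : ∀ z ∈ disc, c * ENNReal.ofReal (1 - ‖z‖ ^ 2) ≤ poissonIntegral μ z := fun z hz => by
    have hz1 : ‖z‖ < 1 := mem_disc.mp hz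
    have h0 : 0 ≤ 1 - ‖z‖ ^ 2 := by nlinarith [norm_nonneg z]
    rw [hc, poissonIntegral, mul_assoc]
    refine mul_le_mul_right ?_ _
    calc ENNReal.ofReal (1 / 4) * μ univ * ENNReal.ofReal (1 - ‖z‖ ^ 2)
        = ∫⁻ _ : UnitCircle, ENNReal.ofReal (1 / 4 * (1 - ‖z‖ ^ 2)) ∂μ := by
          rw [lintegral_const, ENNReal.ofReal_mul (by norm_num)]
          ring
      _ ≤ _ := lintegral_mono fun ξ => ENNReal.ofReal_le_ofReal ?_
    have hξ : ‖(ξ : ℂ)‖ = 1 := norm_eq_of_mem_sphere ξ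
    have h1 : 0 < ‖(ξ : ℂ) - z‖ := by
      rw [norm_pos_iff, sub_ne_zero]
      rintro rfl
      exact absurd hξ hz1.ne
    have h2 : ‖(ξ : ℂ) - z‖ ≤ 2 := le_trans (norm_sub_le _ _) (by rw [hξ]; linarith)
    rw [poissonKernel_circle, le_div_iff₀ (by positivity)]
    nlinarith [mul_nonneg h0 (by nlinarith : 0 ≤ 4 - ‖(ξ : ℂ) - z‖ ^ 2)]
  refine ⟨2 * c⁻¹, ENNReal.mul_ne_top (by norm_num) (ENNReal.inv_ne_top.mpr hc0),
    fun r hr g hg => (lintegral_circleMeasure_le_area hr hg).trans ?_⟩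
  rw [mul_assoc]
  refine add_le_add le_rfl (mul_le_mul_right ?_ _)
  have hm : Measurable fun z => ‖deriv g z‖ₑ ^ 2 := (measurable_deriv g).enorm.pow_const 2
  rw [poissonMeasure, lintegral_withDensity_eq_lintegral_mul _ (measurable_poissonIntegral μ) hm,
    ← lintegral_const_mul _ ((measurable_poissonIntegral μ).mul hm)]
  refine lintegral_mono_ae ?_
  filter_upwards [ae_mem_disc_areaMeasure] with z hz
  calc ‖deriv g z‖ₑ ^ 2 * ENNReal.ofReal (1 - ‖z‖ ^ 2)
      = c⁻¹ * (c * ENNReal.ofReal (1 - ‖z‖ ^ 2) * ‖deriv g z‖ₑ ^ 2) := by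
        rw [← mul_assoc, ← mul_assoc, ENNReal.inv_mul_cancel hc0 hct, one_mul, mul_comm]
    _ ≤ _ := mul_le_mul_right (mul_le_mul_left (hP z hz) _) _

/-! ### Separately holomorphic functions on the bidisc -/

/-- Continuous functions on the bidisc that are holomorphic in each variable separately. This class
contains the holomorphic functions and is visibly stable under partial derivatives. -/
structure SepHol (f : ℂ × ℂ → ℂ) : Prop where
  continuousOn : ContinuousOn f bidisc
  fst : ∀ w ∈ disc, DifferentiableOn ℂ (fun z => f (z, w)) disc
  snd : ∀ z ∈ disc, DifferentiableOn ℂ (fun w => f (z, w)) disc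

theorem isOpen_bidisc : IsOpen bidisc := isOpen_disc.prod isOpen_disc

theorem DifferentiableOn.sepHol {f : ℂ × ℂ → ℂ} (hf : DifferentiableOn ℂ f bidisc) :
    SepHol f where
  continuousOn := hf.continuousOn
  fst w hw := hf.comp (by fun_prop) fun z hz => ⟨hz, hw⟩
  snd z hz := hf.comp (by fun_prop) fun w hw => ⟨hz, hw⟩

namespace SepHol

variable {f : ℂ × ℂ → ℂ}

theorem swap (hf : SepHol f) : SepHol (f ∘ Prod.swap) where
  continuousOn := hf.continuousOn.comp continuous_swap.continuousOn fun _ hz => ⟨hz.2, hz.1⟩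
  fst w hw := hf.snd w hw
  snd z hz := hf.fst z hz

/-- Difference quotients in the first variable converge locally uniformly in both variables. By the
Schwarz lemma applied twice, their distance to the derivative is at most a multiple of the step. -/
theorem exists_tendstoUniformlyOn (hf : SepHol f) {z₀ w₀ : ℂ} (hz₀ : z₀ ∈ disc) (hw₀ : w₀ ∈ disc) :
    ∃ δ > 0, Metric.ball z₀ (2 * δ) ⊆ disc ∧ Metric.ball w₀ δ ⊆ disc ∧
      TendstoUniformlyOn (fun (h : ℂ) (p : ℂ × ℂ) => (f (p.1 + h, p.2) - f p) / h) (partialFst f)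
        (𝓝[≠] 0) (Metric.ball z₀ δ ×ˢ Metric.ball w₀ δ) := by
  have hnhds : {p : ℂ × ℂ | p ∈ bidisc ∧ dist (f p) (f (z₀, w₀)) < 1} ∈ 𝓝 (z₀, w₀) := by
    have hb : bidisc ∈ 𝓝 (z₀, w₀) := isOpen_bidisc.mem_nhds ⟨hz₀, hw₀⟩
    exact inter_mem hb
      ((hf.continuousOn.continuousAt hb).eventually (Metric.ball_mem_nhds _ one_pos))
  obtain ⟨ε, hε, hball⟩ := Metric.mem_nhds_iff.mp hnhds
  rw [← ball_prod_same] at hball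
  obtain ⟨δ, hδ, rfl⟩ : ∃ δ > 0, ε = 3 * δ := ⟨ε / 3, by positivity, by ring⟩
  have hw : ∀ w ∈ Metric.ball w₀ δ, w ∈ Metric.ball w₀ (3 * δ) := fun w hw =>
    Metric.ball_subset_ball (by linarith) hw
  refine ⟨δ, hδ, fun z hz => ?_, fun w hw' => ?_, ?_⟩
  · exact (hball (mk_mem_prod (Metric.ball_subset_ball (by linarith) hz)
      (Metric.mem_ball_self (by linarith)))).1.1
  · exact (hball (mk_mem_prod (Metric.mem_ball_self (by linarith)) (hw w hw'))).1.2
  have key : ∀ p ∈ Metric.ball z₀ δ ×ˢ Metric.ball w₀ δ, ∀ h : ℂ, h ≠ 0 → ‖h‖ < δ →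
      dist (partialFst f p) ((f (p.1 + h, p.2) - f p) / h) ≤ 3 / δ / (2 * δ) * ‖h‖ := by
    rintro ⟨z, w⟩ ⟨hz, hwb⟩ h hh hhδ
    set g : ℂ → ℂ := fun x => f (x, w) with hg
    have hsub : Metric.ball z (2 * δ) ⊆ Metric.ball z₀ (3 * δ) :=
      Metric.ball_subset_ball' (by
        have := Metric.mem_ball.mp hz
        linarith)
    have hmem : ∀ x ∈ Metric.ball z (2 * δ),
        (x, w) ∈ Metric.ball z₀ (3 * δ) ×ˢ Metric.ball w₀ (3 * δ) :=
      fun x hx => ⟨hsub hx, hw w hwb⟩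
    have hzz : z ∈ Metric.ball z (2 * δ) := Metric.mem_ball_self (by linarith)
    have hgd : DifferentiableOn ℂ g (Metric.ball z (2 * δ)) :=
      (hf.fst w (hball (hmem z hzz)).1.2).mono fun x hx => (hball (hmem x hx)).1.1
    have hgm : MapsTo g (Metric.ball z (2 * δ)) (Metric.closedBall (g z) 2) := fun x hx => by
      have h1 := (hball (hmem x hx)).2
      have h2 := (hball (hmem z hzz)).2
      have h3 := dist_triangle_right (g x) (g z) (f (z₀, w₀))
      exact Metric.mem_closedBall.mpr (by linarith)
    -- The difference quotient is a holomorphic function of the end point, bounded by the Schwarz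
    -- lemma, and hence Lipschitz at `z` by the same lemma.
    have hdd : DifferentiableOn ℂ (dslope g z) (Metric.ball z (2 * δ)) :=
      (Complex.differentiableOn_dslope (Metric.ball_mem_nhds z (by linarith))).mpr hgd
    have hdb : ∀ x ∈ Metric.ball z (2 * δ), ‖dslope g z x‖ ≤ 2 / (2 * δ) := fun x hx =>
      Complex.norm_dslope_le_div_of_mapsTo_ball hgd hgm hx
    have hdm : MapsTo (dslope g z) (Metric.ball z (2 * δ))
        (Metric.closedBall (dslope g z z) (3 / δ)) := fun x hx => by
      rw [Metric.mem_closedBall, dist_eq_norm]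
      have h1 := norm_sub_le (dslope g z x) (dslope g z z)
      have h2 := hdb x hx
      have h3 := hdb z hzz
      have h4 : 2 / (2 * δ) + 2 / (2 * δ) ≤ 3 / δ := by
        rw [← sub_nonneg]
        have : 3 / δ - (2 / (2 * δ) + 2 / (2 * δ)) = 1 / δ := by
          field_simp
          ring
        rw [this]
        positivity
      linarith
    have hzh : z + h ∈ Metric.ball z (2 * δ) := by
      rw [Metric.mem_ball, dist_eq_norm, add_sub_cancel_left]
      linarith
    have h1 := Complex.dist_le_div_mul_dist_of_mapsTo_ball hdd hdm hzh
    rw [dslope_same, dslope_of_ne _ (by simpa using hh), slope_def_field, add_sub_cancel_left,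
      dist_comm, dist_eq_norm (z + h), add_sub_cancel_left] at h1
    exact h1
  rw [Metric.tendstoUniformlyOn_iff]
  intro ε' hε'
  have hC : 0 < 3 / δ / (2 * δ) := by positivity
  have hsmall : Metric.ball (0 : ℂ) (min δ (ε' / (3 / δ / (2 * δ)))) ∈ 𝓝[≠] (0 : ℂ) :=
    mem_nhdsWithin_of_mem_nhds (Metric.ball_mem_nhds _ (by positivity))
  filter_upwards [hsmall, self_mem_nhdsWithin] with h hh1 hh2 p hp
  rw [mem_ball_zero_iff, lt_min_iff] at hh1
  refine lt_of_le_of_lt (key p hp h hh2 hh1.1) ?_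
  rw [mul_comm]
  exact (lt_div_iff₀ hC).mp hh1.2

theorem tendstoLocallyUniformlyOn_slice (hf : SepHol f) {z w₀ : ℂ} (hz : z ∈ disc)
    (hw₀ : w₀ ∈ disc) : ∃ δ > 0, Metric.ball w₀ δ ⊆ disc ∧
      TendstoLocallyUniformlyOn (fun (h w : ℂ) => (f (z + h, w) - f (z, w)) / h)
        (fun w => partialFst f (z, w)) (𝓝[≠] 0) (Metric.ball w₀ δ) ∧
      ∀ᶠ h in 𝓝[≠] (0 : ℂ), DifferentiableOn ℂ
        (fun w : ℂ => (f (z + h, w) - f (z, w)) / h) (Metric.ball w₀ δ) := by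
  obtain ⟨δ, hδ, hzd, hwd, hT⟩ := hf.exists_tendstoUniformlyOn hz hw₀
  refine ⟨δ, hδ, hwd, TendstoUniformlyOn.tendstoLocallyUniformlyOn ?_, ?_⟩
  · have h1 := hT.comp (fun w : ℂ => (z, w))
    exact h1.mono fun w hw => ⟨Metric.mem_ball_self hδ, hw⟩
  · filter_upwards [mem_nhdsWithin_of_mem_nhds (Metric.ball_mem_nhds (0 : ℂ) hδ)] with h hh
    have hzh : z + h ∈ disc := hzd (by
      rw [mem_ball_zero_iff] at hh
      rw [Metric.mem_ball, dist_eq_norm, add_sub_cancel_left]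
      linarith)
    exact (((hf.snd _ hzh).mono hwd).sub ((hf.snd _ hz).mono hwd)).div_const h

theorem derivFst (hf : SepHol f) : SepHol (partialFst f) where
  continuousOn := by
    rintro ⟨z₀, w₀⟩ ⟨hz₀, hw₀⟩
    obtain ⟨δ, hδ, hzd, hwd, hT⟩ := hf.exists_tendstoUniformlyOn hz₀ hw₀
    have hopen : IsOpen (Metric.ball z₀ δ ×ˢ Metric.ball w₀ δ) :=
      Metric.isOpen_ball.prod Metric.isOpen_ball
    refine ContinuousAt.continuousWithinAt (ContinuousOn.continuousAt (hT.continuousOn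
      (Eventually.frequently ?_)) (hopen.mem_nhds
        ⟨Metric.mem_ball_self hδ, Metric.mem_ball_self hδ⟩))
    filter_upwards [mem_nhdsWithin_of_mem_nhds (Metric.ball_mem_nhds (0 : ℂ) hδ)] with h hh
    rw [mem_ball_zero_iff] at hh
    refine ContinuousOn.div_const (ContinuousOn.sub ?_ ?_) h
    · refine hf.continuousOn.comp (by fun_prop) fun p hp => ⟨hzd ?_, hwd hp.2⟩
      have h1 : dist p.1 z₀ < δ := hp.1
      rw [Metric.mem_ball, dist_eq_norm, add_sub_right_comm]
      rw [dist_eq_norm] at h1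
      have h2 := norm_add_le (p.1 - z₀) h
      linarith
    · exact hf.continuousOn.mono fun p hp =>
        ⟨hzd (Metric.ball_subset_ball (by linarith) hp.1), hwd hp.2⟩
  fst w hw := (hf.fst w hw).deriv isOpen_disc
  snd z hz := fun w₀ hw₀ => by
    obtain ⟨δ, hδ, hwd, hT, hd⟩ := hf.tendstoLocallyUniformlyOn_slice hz hw₀
    exact ((hT.differentiableOn hd Metric.isOpen_ball).differentiableAt
      (Metric.ball_mem_nhds _ hδ)).differentiableWithinAt

theorem derivSnd (hf : SepHol f) : SepHol (partialSnd f) := hf.swap.derivFst.swap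

/-- Mixed partial derivatives commute. -/
theorem partialFst_partialSnd (hf : SepHol f) {z : ℂ × ℂ} (hz : z ∈ bidisc) :
    partialFst (partialSnd f) z
      = partialSnd (partialFst f) z := by
  obtain ⟨z, w⟩ := z
  obtain ⟨hz, hw⟩ := hz
  obtain ⟨δ, hδ, hwd, hT, hd⟩ := hf.tendstoLocallyUniformlyOn_slice hz hw
  have h1 := (hT.deriv hd Metric.isOpen_ball).tendsto_at (Metric.mem_ball_self hδ)
  refine HasDerivAt.deriv (hasDerivAt_iff_tendsto_slope_zero.mpr (h1.congr' ?_))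
  obtain ⟨ε, hε, hzd⟩ := Metric.mem_nhds_iff.mp (isOpen_disc.mem_nhds hz)
  filter_upwards [mem_nhdsWithin_of_mem_nhds (Metric.ball_mem_nhds (0 : ℂ) hε)] with h hh
  have hzh : z + h ∈ disc := hzd (by
    rw [Metric.mem_ball, dist_eq_norm, add_sub_cancel_left]
    exact mem_ball_zero_iff.mp hh)
  have h2 : ∀ x ∈ disc, DifferentiableAt ℂ (fun w => f (x, w)) w := fun x hx =>
    (hf.snd x hx).differentiableAt (isOpen_disc.mem_nhds hw)
  simp only [Function.comp_apply]
  rw [deriv_div_const, deriv_fun_sub (h2 _ hzh) (h2 _ hz), smul_eq_mul, div_eq_inv_mul]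
  rfl

end SepHol

/-! ### Fejér means in the first variable -/

theorem partialFst_eqOn {f g : ℂ × ℂ → ℂ} (h : EqOn f g bidisc) :
    EqOn (partialFst f) (partialFst g) bidisc := fun z hz => by
  refine Filter.EventuallyEq.deriv_eq ?_
  filter_upwards [isOpen_disc.mem_nhds hz.1] with x hx
  exact h ⟨hx, hz.2⟩

theorem partialSnd_eqOn {f g : ℂ × ℂ → ℂ} (h : EqOn f g bidisc) :
    EqOn (partialSnd f) (partialSnd g) bidisc := fun z hz => by
  refine Filter.EventuallyEq.deriv_eq ?_
  filter_upwards [isOpen_disc.mem_nhds hz.2] with x hx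
  exact h ⟨hz.1, hx⟩

theorem iterate_partialFst_eqOn {f g : ℂ × ℂ → ℂ} (h : EqOn f g bidisc) (i : ℕ) :
    EqOn (partialFst^[i] f) (partialFst^[i] g) bidisc := by
  induction i with
  | zero => exact h
  | succ i ih =>
    rw [Function.iterate_succ_apply', Function.iterate_succ_apply']
    exact partialFst_eqOn ih

theorem iterate_partialFst_apply (f : ℂ × ℂ → ℂ) (i : ℕ) (z w : ℂ) :
    partialFst^[i] f (z, w) = deriv^[i] (fun x => f (x, w)) z := by
  induction i generalizing z with
  | zero => rfl
  | succ i ih =>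
    rw [Function.iterate_succ_apply', Function.iterate_succ_apply', partialFst]
    simp_rw [ih]

theorem iterate_partialSnd_apply (f : ℂ × ℂ → ℂ) (j : ℕ) (z w : ℂ) :
    partialSnd^[j] f (z, w) = deriv^[j] (fun x => f (z, x)) w := by
  induction j generalizing w with
  | zero => rfl
  | succ j ih =>
    rw [Function.iterate_succ_apply', Function.iterate_succ_apply', partialSnd]
    simp_rw [ih]

namespace SepHol

variable {f g : ℂ × ℂ → ℂ}

theorem iterate_derivFst (hf : SepHol f) (i : ℕ) : SepHol (partialFst^[i] f) := by
  induction i with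
  | zero => exact hf
  | succ i ih =>
    rw [Function.iterate_succ_apply']
    exact ih.derivFst

theorem iterate_derivSnd (hf : SepHol f) (j : ℕ) : SepHol (partialSnd^[j] f) := by
  induction j with
  | zero => exact hf
  | succ j ih =>
    rw [Function.iterate_succ_apply']
    exact ih.derivSnd

theorem iterate_partialFst_partialSnd (hf : SepHol f) (i : ℕ) :
    EqOn (partialFst^[i] (partialSnd f))
      (partialSnd (partialFst^[i] f)) bidisc := by
  induction i with
  | zero => exact fun _ _ => rfl
  | succ i ih =>
    rw [Function.iterate_succ_apply', Function.iterate_succ_apply']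
    exact (partialFst_eqOn ih).trans fun z hz => (hf.iterate_derivFst i).partialFst_partialSnd hz

theorem iterate_comm (hf : SepHol f) (i j : ℕ) :
    EqOn (partialFst^[i] (partialSnd^[j] f))
      (partialSnd^[j] (partialFst^[i] f)) bidisc := by
  induction j with
  | zero => exact fun _ _ => rfl
  | succ j ih =>
    rw [Function.iterate_succ_apply', Function.iterate_succ_apply']
    exact ((hf.iterate_derivSnd j).iterate_partialFst_partialSnd i).trans (partialSnd_eqOn ih)

theorem add_const_mul (hf : SepHol f) (hg : SepHol g) (c : ℂ) : SepHol fun z => f z + c * g z where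
  continuousOn := hf.continuousOn.add (hg.continuousOn.const_mul c)
  fst w hw := (hf.fst w hw).add ((hg.fst w hw).const_mul c)
  snd z hz := (hf.snd z hz).add ((hg.snd z hz).const_mul c)

theorem add (hf : SepHol f) (hg : SepHol g) : SepHol (f + g) := by
  have h := hf.add_const_mul hg 1
  simp only [one_mul] at h
  exact h

theorem sub (hf : SepHol f) (hg : SepHol g) : SepHol (f - g) := by
  have h := hf.add_const_mul hg (-1)
  simp only [neg_mul, one_mul, ← sub_eq_add_neg] at h
  exact h

end SepHol

/-- The derivative `∂₁ⁱ ∂₂ʲ f`. -/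
noncomputable def mixedDeriv (i j : ℕ) (f : ℂ × ℂ → ℂ) : ℂ × ℂ → ℂ :=
  partialFst^[i] (partialSnd^[j] f)

theorem SepHol.mixed {f : ℂ × ℂ → ℂ} (hf : SepHol f) (i j : ℕ) :
    SepHol (mixedDeriv i j f) :=
  (hf.iterate_derivSnd j).iterate_derivFst i

theorem partialFst_add_const_mul {f g : ℂ × ℂ → ℂ} (hf : SepHol f) (hg : SepHol g) (c : ℂ) :
    EqOn (partialFst fun z => f z + c * g z) (fun z => partialFst f z + c * partialFst g z)
      bidisc := fun z hz => by
  have h1 := (hf.fst z.2 hz.2).differentiableAt (isOpen_disc.mem_nhds hz.1)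
  have h2 := (hg.fst z.2 hz.2).differentiableAt (isOpen_disc.mem_nhds hz.1)
  exact (h1.hasDerivAt.add (h2.hasDerivAt.const_mul c)).deriv

theorem partialSnd_add_const_mul {f g : ℂ × ℂ → ℂ} (hf : SepHol f) (hg : SepHol g) (c : ℂ) :
    EqOn (partialSnd fun z => f z + c * g z) (fun z => partialSnd f z + c * partialSnd g z)
      bidisc := fun z hz => by
  have h1 := (hf.snd z.1 hz.1).differentiableAt (isOpen_disc.mem_nhds hz.2)
  have h2 := (hg.snd z.1 hz.1).differentiableAt (isOpen_disc.mem_nhds hz.2)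
  exact (h1.hasDerivAt.add (h2.hasDerivAt.const_mul c)).deriv

theorem mixedDeriv_add_const_mul {f g : ℂ × ℂ → ℂ} (hf : SepHol f) (hg : SepHol g) (c : ℂ)
    (i j : ℕ) : EqOn (mixedDeriv i j fun z => f z + c * g z)
      (fun z => mixedDeriv i j f z + c * mixedDeriv i j g z) bidisc := by
  have h1 : EqOn (partialSnd^[j] fun z => f z + c * g z)
      (fun z => partialSnd^[j] f z + c * partialSnd^[j] g z) bidisc := by
    induction j with
    | zero => exact fun _ _ => rfl
    | succ j ih =>
      simp only [Function.iterate_succ_apply']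
      exact (partialSnd_eqOn ih).trans
        (partialSnd_add_const_mul (hf.iterate_derivSnd j) (hg.iterate_derivSnd j) c)
  induction i with
  | zero => exact h1
  | succ i ih =>
    simp only [mixedDeriv, Function.iterate_succ_apply'] at ih ⊢
    exact (partialFst_eqOn ih).trans
      (partialFst_add_const_mul (hf.mixed i j) (hg.mixed i j) c)

theorem mixedDeriv_add {f g : ℂ × ℂ → ℂ} (hf : SepHol f) (hg : SepHol g) (i j : ℕ) {z : ℂ × ℂ}
    (hz : z ∈ bidisc) : mixedDeriv i j (f + g) z = mixedDeriv i j f z + mixedDeriv i j g z := by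
  have h := mixedDeriv_add_const_mul hf hg 1 i j hz
  simp only [one_mul] at h
  exact h

theorem mixedDeriv_sub {f g : ℂ × ℂ → ℂ} (hf : SepHol f) (hg : SepHol g) (i j : ℕ) {z : ℂ × ℂ}
    (hz : z ∈ bidisc) : mixedDeriv i j (f - g) z = mixedDeriv i j f z - mixedDeriv i j g z := by
  have h := mixedDeriv_add_const_mul hf hg (-1) i j hz
  simp only [neg_mul, one_mul, ← sub_eq_add_neg] at h
  exact h

/-- The Fejér mean in the first variable, the second variable being a parameter. -/
noncomputable def fejerFst (N : ℕ) (f : ℂ × ℂ → ℂ) (z : ℂ × ℂ) : ℂ :=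
  fejer N (fun x => f (x, z.2)) z.1

/-- Taylor coefficients in the first variable are holomorphic in the second one, and `∂₂` acts on
them. -/
theorem SepHol.hasDerivAt_taylorCoeff {f : ℂ × ℂ → ℂ} (hf : SepHol f) (n : ℕ) {w : ℂ}
    (hw : w ∈ disc) : HasDerivAt (fun w => taylorCoeff n fun x => f (x, w))
      (taylorCoeff n fun x => partialSnd f (x, w)) w := by
  have e : ∀ (g : ℂ × ℂ → ℂ) (w : ℂ), taylorCoeff n (fun x => g (x, w))
      = (n.factorial : ℂ)⁻¹ * partialFst^[n] g (0, w) := fun g w => by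
    rw [taylorCoeff, iteratedDeriv_eq_iterate, iterate_partialFst_apply]
  simp_rw [e]
  rw [hf.iterate_partialFst_partialSnd n (mk_mem_prod zero_mem_disc hw)]
  exact (((hf.iterate_derivFst n).snd 0 zero_mem_disc).differentiableAt
    (isOpen_disc.mem_nhds hw)).hasDerivAt.const_mul _

theorem SepHol.fejerMean {f : ℂ × ℂ → ℂ} (hf : SepHol f) (N : ℕ) : SepHol (fejerFst N f) where
  continuousOn := by
    unfold fejerFst fejer
    refine continuousOn_finsetSum _ fun n _ => ContinuousOn.mul (continuousOn_const.mul ?_)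
      (by fun_prop)
    have h : ContinuousOn (fun w => taylorCoeff n fun x => f (x, w)) disc := fun w hw =>
      (hf.hasDerivAt_taylorCoeff n hw).continuousAt.continuousWithinAt
    exact h.comp continuousOn_snd fun z hz => hz.2
  fst w _ := (differentiable_fejer N fun x => f (x, w)).differentiableOn
  snd z _ := by
    unfold fejerFst fejer
    refine DifferentiableOn.fun_sum fun n _ => ?_
    have h : DifferentiableOn ℂ (fun w => taylorCoeff n fun x => f (x, w)) disc := fun w hw =>
      (hf.hasDerivAt_taylorCoeff n hw).differentiableAt.differentiableWithinAt
    exact (h.const_mul (fejerWeight N n : ℂ)).mul_const (z ^ n)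

theorem SepHol.partialSnd_fejerFst {f : ℂ × ℂ → ℂ} (hf : SepHol f) (N : ℕ) :
    EqOn (partialSnd (fejerFst N f))
      (fejerFst N (partialSnd f)) bidisc := fun z hz =>
  (HasDerivAt.fun_sum (u := Finset.range N) fun n _ =>
    ((hf.hasDerivAt_taylorCoeff n hz.2).const_mul (fejerWeight N n : ℂ)).mul_const (z.1 ^ n)).deriv

theorem SepHol.iterate_partialSnd_fejerFst {f : ℂ × ℂ → ℂ} (hf : SepHol f) (N j : ℕ) :
    EqOn (partialSnd^[j] (fejerFst N f))
      (fejerFst N (partialSnd^[j] f)) bidisc := by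
  induction j with
  | zero => exact fun _ _ => rfl
  | succ j ih =>
    rw [Function.iterate_succ_apply', Function.iterate_succ_apply']
    exact (partialSnd_eqOn ih).trans ((hf.iterate_derivSnd j).partialSnd_fejerFst N)

theorem SepHol.mixedDeriv_fejerFst {f : ℂ × ℂ → ℂ} (hf : SepHol f) (N i j : ℕ) {z w : ℂ}
    (hz : z ∈ disc) (hw : w ∈ disc) :
    mixedDeriv i j (fejerFst N f) (z, w)
      = deriv^[i] (fejer N fun x => partialSnd^[j] f (x, w)) z := by
  rw [mixedDeriv,
    iterate_partialFst_eqOn (hf.iterate_partialSnd_fejerFst N j) i (mk_mem_prod hz hw),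
    iterate_partialFst_apply]
  rfl

theorem SepHol.tendsto_mixedDeriv_fejerFst {f : ℂ × ℂ → ℂ} (hf : SepHol f) (i j : ℕ) {z : ℂ × ℂ}
    (hz : z ∈ bidisc) :
    Tendsto (fun N => mixedDeriv i j (fejerFst N f) z) atTop
      (𝓝 (mixedDeriv i j f z)) := by
  obtain ⟨z, w⟩ := z
  simp_rw [hf.mixedDeriv_fejerFst _ i j hz.1 hz.2]
  rw [mixedDeriv, iterate_partialFst_apply]
  exact tendsto_iterate_deriv_fejer ((hf.iterate_derivSnd j).fst w hz.2) i hz.1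

/-! ### Convergence of Fejér means in energy -/

/-- The integral of `‖∂₁ⁱ ∂₂ʲ f‖²` against the product of `α r` and `β r`. -/
noncomputable def energyAt (i j : ℕ) (α β : ℝ → Measure ℂ) (r : ℝ) (f : ℂ × ℂ → ℂ) : ℝ≥0∞ :=
  ∫⁻ z, ‖mixedDeriv i j f z‖ₑ ^ 2 ∂(α r).prod (β r)

/-- The supremum of the integrals `energyAt` over `0 < r < 1`. The square of the norm of the
Dirichlet-type space is the sum of four such quantities. -/
noncomputable def energy (i j : ℕ) (α β : ℝ → Measure ℂ) (f : ℂ × ℂ → ℂ) : ℝ≥0∞ :=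
  ⨆ r ∈ Ioo (0 : ℝ) 1, energyAt i j α β r f

section Energy

variable {i j : ℕ} {α β : ℝ → Measure ℂ} {f g : ℂ × ℂ → ℂ} {r : ℝ}

theorem ae_mem_bidisc (hα : Admissible i α) (hβ : Admissible j β) (hr : r ∈ Ioo (0 : ℝ) 1) :
    ∀ᵐ z ∂(α r).prod (β r), z ∈ bidisc := by
  have := hα.sFinite r
  have := hβ.sFinite r
  filter_upwards [Measure.quasiMeasurePreserving_fst.ae (hα.ae_mem r hr),
    Measure.quasiMeasurePreserving_snd.ae (hβ.ae_mem r hr)] with z h1 h2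
  exact ⟨h1, h2⟩

theorem aemeasurable_sq_enorm (hα : Admissible i α) (hβ : Admissible j β) {r s : ℝ}
    (hr : r ∈ Ioo (0 : ℝ) 1) (hs : s ∈ Ioo (0 : ℝ) 1) (hf : ContinuousOn f bidisc) :
    AEMeasurable (fun z => ‖f z‖ₑ ^ 2) ((α r).prod (β s)) := by
  have := hα.sFinite r
  have := hβ.sFinite s
  refine (ContinuousOn.aemeasurable_of_ae_mem hf isOpen_bidisc ?_).enorm.pow_const 2
  filter_upwards [Measure.quasiMeasurePreserving_fst.ae (hα.ae_mem r hr),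
    Measure.quasiMeasurePreserving_snd.ae (hβ.ae_mem s hs)] with z h1 h2
  exact ⟨h1, h2⟩

theorem energyAt_fejerFst_le (hα : Admissible i α) (hβ : Admissible j β)
    (hr : r ∈ Ioo (0 : ℝ) 1) (hf : SepHol f) {N : ℕ} (hN : 0 < N) :
    energyAt i j α β r (fejerFst N f) ≤ energyAt i j α β r f := by
  have := hα.sFinite r
  have := hβ.sFinite r
  rw [energyAt, energyAt, lintegral_prod_symm _ (aemeasurable_sq_enorm hα hβ hr hr
    ((hf.fejerMean N).mixed i j).continuousOn), lintegral_prod_symm _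
    (aemeasurable_sq_enorm hα hβ hr hr (hf.mixed i j).continuousOn)]
  refine lintegral_mono_ae ?_
  filter_upwards [hβ.ae_mem r hr] with w hw
  have h := hα.fejer_le _ ((hf.iterate_derivSnd j).fst w hw) r hr N hN
  refine le_trans (le_of_eq (lintegral_congr_ae ?_))
    (h.trans (le_of_eq (lintegral_congr fun z => ?_)))
  · filter_upwards [hα.ae_mem r hr] with z hz
    rw [hf.mixedDeriv_fejerFst N i j hz hw]
  · rw [mixedDeriv, iterate_partialFst_apply]

/-- The radius is increased in one variable at a time, first in the first one. -/
theorem energyAt_mono (hα : Admissible i α) (hβ : Admissible j β) (hf : SepHol f) {r s : ℝ}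
    (hr : r ∈ Ioo (0 : ℝ) 1) (hs : s ∈ Ioo (0 : ℝ) 1) (hrs : r ≤ s) :
    energyAt i j α β r f ≤ energyAt i j α β s f := by
  have := hα.sFinite r
  have := hβ.sFinite r
  have := hα.sFinite s
  have := hβ.sFinite s
  have hc := (hf.mixed i j).continuousOn
  calc energyAt i j α β r f
      ≤ ∫⁻ z, ‖mixedDeriv i j f z‖ₑ ^ 2 ∂(α s).prod (β r) := by
        rw [energyAt, lintegral_prod_symm _ (aemeasurable_sq_enorm hα hβ hr hr hc),
          lintegral_prod_symm _ (aemeasurable_sq_enorm hα hβ hs hr hc)]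
        refine lintegral_mono_ae ?_
        filter_upwards [hβ.ae_mem r hr] with w hw
        have h := hα.mono _ ((hf.iterate_derivSnd j).fst w hw) r hr s hs hrs
        simpa only [mixedDeriv, iterate_partialFst_apply] using h
    _ ≤ energyAt i j α β s f := by
        rw [energyAt, lintegral_prod _ (aemeasurable_sq_enorm hα hβ hs hr hc),
          lintegral_prod _ (aemeasurable_sq_enorm hα hβ hs hs hc)]
        refine lintegral_mono_ae ?_
        filter_upwards [hα.ae_mem s hs] with z hz
        have h := hβ.mono _ ((hf.iterate_derivFst i).snd z hz) r hr s hs hrs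
        have e : ∀ t ∈ Ioo (0 : ℝ) 1, ∫⁻ w, ‖mixedDeriv i j f (z, w)‖ₑ ^ 2 ∂β t
            = ∫⁻ w, ‖deriv^[j] (fun w => partialFst^[i] f (z, w)) w‖ₑ ^ 2 ∂β t := fun t ht => by
          refine lintegral_congr_ae ?_
          filter_upwards [hβ.ae_mem t ht] with w hw
          rw [mixedDeriv, hf.iterate_comm i j (mk_mem_prod hz hw), iterate_partialSnd_apply]
        rw [e r hr, e s hs]
        exact h

theorem sq_enorm_sub_add_sq_enorm_add (a b : ℂ) :
    ‖a - b‖ₑ ^ 2 + ‖a + b‖ₑ ^ 2 = 2 * ‖a‖ₑ ^ 2 + 2 * ‖b‖ₑ ^ 2 := by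
  simp_rw [← ofReal_norm]
  rw [← ENNReal.ofReal_ofNat 2, ← ENNReal.ofReal_pow (norm_nonneg _),
    ← ENNReal.ofReal_pow (norm_nonneg _), ← ENNReal.ofReal_pow (norm_nonneg _),
    ← ENNReal.ofReal_pow (norm_nonneg _), ← ENNReal.ofReal_mul (by norm_num),
    ← ENNReal.ofReal_mul (by norm_num), ← ENNReal.ofReal_add (by positivity) (by positivity),
    ← ENNReal.ofReal_add (by positivity) (by positivity)]
  congr 1
  have := parallelogram_law_with_norm ℝ a b
  linarith

theorem energyAt_sub_add (hα : Admissible i α) (hβ : Admissible j β) (hr : r ∈ Ioo (0 : ℝ) 1)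
    (hf : SepHol f) (hg : SepHol g) :
    energyAt i j α β r (f - g) + energyAt i j α β r (f + g)
      = 2 * energyAt i j α β r f + 2 * energyAt i j α β r g := by
  have hm : ∀ {h : ℂ × ℂ → ℂ}, SepHol h → AEMeasurable (fun z => ‖mixedDeriv i j h z‖ₑ ^ 2)
      ((α r).prod (β r)) := fun hh =>
    aemeasurable_sq_enorm hα hβ hr hr (hh.mixed i j).continuousOn
  simp only [energyAt]
  rw [← lintegral_const_mul'' _ (hm hf), ← lintegral_const_mul'' _ (hm hg),
    ← lintegral_add_left' (hm (hf.sub hg)), ← lintegral_add_left' ((hm hf).const_mul 2)]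
  refine lintegral_congr_ae ?_
  filter_upwards [ae_mem_bidisc hα hβ hr] with z hz
  rw [mixedDeriv_sub hf hg i j hz, mixedDeriv_add hf hg i j hz, sq_enorm_sub_add_sq_enorm_add]

theorem energyAt_le_energy (hr : r ∈ Ioo (0 : ℝ) 1) : energyAt i j α β r f ≤ energy i j α β f :=
  le_iSup₂ (f := fun r (_ : r ∈ Ioo (0 : ℝ) 1) => energyAt i j α β r f) r hr

theorem energy_fejerFst_le (hα : Admissible i α) (hβ : Admissible j β) (hf : SepHol f) {N : ℕ}
    (hN : 0 < N) : energy i j α β (fejerFst N f) ≤ energy i j α β f :=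
  iSup₂_mono fun _ hr => energyAt_fejerFst_le hα hβ hr hf hN

theorem energy_sub_add_le (hα : Admissible i α) (hβ : Admissible j β) (hf : SepHol f)
    (hg : SepHol g) : energy i j α β (f - g) + energy i j α β (f + g)
      ≤ 2 * energy i j α β f + 2 * energy i j α β g := by
  have hne : ∃ r : ℝ, r ∈ Ioo (0 : ℝ) 1 := ⟨1 / 2, by norm_num, by norm_num⟩
  refine ENNReal.biSup_add_biSup_le' hne hne fun r hr s hs => ?_
  have ht : max r s ∈ Ioo (0 : ℝ) 1 := ⟨lt_max_of_lt_left hr.1, max_lt hr.2 hs.2⟩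
  calc energyAt i j α β r (f - g) + energyAt i j α β s (f + g)
      ≤ energyAt i j α β (max r s) (f - g) + energyAt i j α β (max r s) (f + g) :=
        add_le_add (energyAt_mono hα hβ (hf.sub hg) hr ht (le_max_left _ _))
          (energyAt_mono hα hβ (hf.add hg) hs ht (le_max_right _ _))
    _ = 2 * energyAt i j α β (max r s) f + 2 * energyAt i j α β (max r s) g :=
        energyAt_sub_add hα hβ ht hf hg
    _ ≤ _ := add_le_add (mul_le_mul_right (energyAt_le_energy ht) _)
        (mul_le_mul_right (energyAt_le_energy ht) _)

/-- Lower semicontinuity along `f + fejerFst N f`, whose derivatives converge pointwise to those of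
`2 f`, by Fatou's lemma. -/
theorem four_mul_energy_le_liminf (hα : Admissible i α) (hβ : Admissible j β) (hf : SepHol f) :
    4 * energy i j α β f ≤ liminf (fun N => energy i j α β (f + fejerFst N f)) atTop := by
  simp only [energy, ENNReal.mul_iSup]
  refine iSup₂_le fun r hr => ?_
  have hm : ∀ {h : ℂ × ℂ → ℂ}, SepHol h → AEMeasurable (fun z => ‖mixedDeriv i j h z‖ₑ ^ 2)
      ((α r).prod (β r)) := fun hh =>
    aemeasurable_sq_enorm hα hβ hr hr (hh.mixed i j).continuousOn
  calc 4 * energyAt i j α β r f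
      = ∫⁻ z, 4 * ‖mixedDeriv i j f z‖ₑ ^ 2 ∂(α r).prod (β r) :=
        (lintegral_const_mul'' _ (hm hf)).symm
    _ = ∫⁻ z, liminf (fun N => ‖mixedDeriv i j (f + fejerFst N f) z‖ₑ ^ 2) atTop
          ∂(α r).prod (β r) := by
        refine lintegral_congr_ae ?_
        filter_upwards [ae_mem_bidisc hα hβ hr] with z hz
        simp_rw [fun N => mixedDeriv_add hf (hf.fejerMean N) i j hz]
        have h1 := (hf.tendsto_mixedDeriv_fejerFst i j hz).const_add (mixedDeriv i j f z)
        have h2 := ((ENNReal.continuous_pow 2).tendsto _).comp h1.enorm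
        rw [show liminf (fun N => ‖mixedDeriv i j f z + mixedDeriv i j (fejerFst N f) z‖ₑ ^ 2) atTop
          = _ from h2.liminf_eq, ← two_mul, enorm_mul, mul_pow]
        congr 1
        rw [← ofReal_norm, Complex.norm_ofNat, ENNReal.ofReal_ofNat]
        norm_num
    _ ≤ liminf (fun N => energyAt i j α β r (f + fejerFst N f)) atTop :=
        lintegral_liminf_le' fun N => hm (hf.add (hf.fejerMean N))
    _ ≤ _ := liminf_le_liminf (Eventually.of_forall fun N => energyAt_le_energy hr)

theorem tendsto_zero_of_add_le_of_le_liminf {x y : ℕ → ℝ≥0∞} {M : ℝ≥0∞} (hM : M ≠ ∞)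
    (h : ∀ᶠ n in atTop, x n + y n ≤ M) (hy : M ≤ liminf y atTop) : Tendsto x atTop (𝓝 0) := by
  rw [ENNReal.tendsto_nhds_zero]
  intro ε hε
  rcases eq_or_ne M 0 with h0 | h0
  · filter_upwards [h] with n hn
    exact (le_self_add.trans hn).trans (by simp [h0])
  · have h1 : M - ε < liminf y atTop := lt_of_lt_of_le (ENNReal.sub_lt_self hM h0 hε.ne') hy
    filter_upwards [h, eventually_lt_of_lt_liminf h1] with n hn hn1
    have hyn : y n ≠ ∞ := ne_top_of_le_ne_top hM (le_add_self.trans hn)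
    have h2 : x n + y n ≤ ε + y n :=
      hn.trans ((tsub_le_iff_left).mp hn1.le)
    exact (ENNReal.add_le_add_iff_right hyn).mp h2

/-- Fejér means converge in energy: they do not increase the energy and they converge pointwise, so
the parallelogram law leaves no room for the energy of the difference. -/
theorem tendsto_energy_sub_fejerFst (hα : Admissible i α) (hβ : Admissible j β) (hf : SepHol f)
    (hfin : energy i j α β f ≠ ∞) :
    Tendsto (fun N => energy i j α β (f - fejerFst N f)) atTop (𝓝 0) := by
  refine tendsto_zero_of_add_le_of_le_liminf (ENNReal.mul_ne_top (by norm_num) hfin) ?_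
    (four_mul_energy_le_liminf hα hβ hf)
  filter_upwards [eventually_gt_atTop 0] with N hN
  calc energy i j α β (f - fejerFst N f) + energy i j α β (f + fejerFst N f)
      ≤ 2 * energy i j α β f + 2 * energy i j α β (fejerFst N f) :=
        energy_sub_add_le hα hβ hf (hf.fejerMean N)
    _ ≤ 2 * energy i j α β f + 2 * energy i j α β f :=
        add_le_add le_rfl (mul_le_mul_right (energy_fejerFst_le hα hβ hf hN) _)
    _ = 4 * energy i j α β f := by
        rw [← add_mul]
        norm_num

theorem iterate_partialFst_swap (f : ℂ × ℂ → ℂ) (i : ℕ) :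
    partialFst^[i] (f ∘ Prod.swap) = partialSnd^[i] f ∘ Prod.swap := by
  induction i with
  | zero => rfl
  | succ i ih =>
    rw [Function.iterate_succ_apply', Function.iterate_succ_apply', ih]
    rfl

theorem iterate_partialSnd_swap (f : ℂ × ℂ → ℂ) (i : ℕ) :
    partialSnd^[i] (f ∘ Prod.swap) = partialFst^[i] f ∘ Prod.swap := by
  induction i with
  | zero => rfl
  | succ i ih =>
    rw [Function.iterate_succ_apply', Function.iterate_succ_apply', ih]
    rfl

theorem energy_swap (hα : Admissible i α) (hβ : Admissible j β) (hf : SepHol f) :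
    energy j i β α (f ∘ Prod.swap) = energy i j α β f := by
  refine biSup_congr fun r hr => ?_
  have := hα.sFinite r
  have := hβ.sFinite r
  rw [energyAt, energyAt, ← lintegral_prod_swap]
  refine lintegral_congr_ae ?_
  filter_upwards [ae_mem_bidisc hα hβ hr] with z hz
  rw [mixedDeriv, iterate_partialSnd_swap, iterate_partialFst_swap, Function.comp_apply,
    Prod.swap_swap, ← hf.iterate_comm i j hz, mixedDeriv]

end Energy

/-! ### The norm of the Dirichlet-type space as a sum of energies -/

theorem energyAt_circle_circle {r : ℝ} (hr : r ∈ Ioo (0 : ℝ) 1) {f : ℂ × ℂ → ℂ} (hf : SepHol f) :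
    ∫⁻ p : ℝ × ℝ, ‖f (polar r p.1, polar r p.2)‖ₑ ^ 2 ∂angleMeasure.prod angleMeasure
      = energyAt 0 0 circleMeasure circleMeasure r f := by
  have hm := aemeasurable_sq_enorm admissible_circleMeasure admissible_circleMeasure hr hr
    hf.continuousOn
  have hp := (continuous_polar r).measurable
  have e : (circleMeasure r).prod (circleMeasure r)
      = (angleMeasure.prod angleMeasure).map (Prod.map (polar r) (polar r)) :=
    Measure.map_prod_map _ _ hp hp
  change _ = ∫⁻ z, ‖f z‖ₑ ^ 2 ∂(circleMeasure r).prod (circleMeasure r)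
  rw [e] at hm ⊢
  exact (lintegral_map' hm (hp.prodMap hp).aemeasurable).symm

theorem energyAt_poisson_circle (μ : Measure UnitCircle) [IsFiniteMeasure μ] {r : ℝ}
    (hr : r ∈ Ioo (0 : ℝ) 1) {f : ℂ × ℂ → ℂ} (hf : SepHol f) :
    ∫⁻ p : ℂ × ℝ, ‖partialFst f (p.1, polar r p.2)‖ₑ ^ 2 * poissonIntegral μ p.1
        ∂areaMeasure.prod angleMeasure
      = energyAt 1 0 (fun _ => poissonMeasure μ) circleMeasure r f := by
  have hm := aemeasurable_sq_enorm (admissible_poissonMeasure μ) admissible_circleMeasure hr hr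
    hf.derivFst.continuousOn
  have hp := (continuous_polar r).measurable
  have hP := measurable_poissonIntegral μ
  have e : (poissonMeasure μ).prod (circleMeasure r)
      = ((areaMeasure.prod angleMeasure).withDensity fun z => poissonIntegral μ z.1).map
        (Prod.map id (polar r)) := by
    rw [← prod_withDensity_left hP, ← Measure.map_prod_map _ _ measurable_id hp, Measure.map_id]
    rfl
  have hc : AEMeasurable (fun p : ℂ × ℝ => ‖partialFst f (p.1, polar r p.2)‖ₑ ^ 2)
      (areaMeasure.prod angleMeasure) := by
    refine (ContinuousOn.aemeasurable_of_ae_mem (s := disc ×ˢ univ) ?_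
      (isOpen_disc.prod isOpen_univ) ?_).enorm.pow_const 2
    · refine hf.derivFst.continuousOn.comp ?_ fun p hp' => ⟨hp'.1, polar_mem_disc hr _⟩
      have := continuous_polar r
      fun_prop
    · filter_upwards [Measure.quasiMeasurePreserving_fst.ae ae_mem_disc_areaMeasure] with z h1
      exact ⟨h1, mem_univ _⟩
  change _ = ∫⁻ z, ‖partialFst f z‖ₑ ^ 2 ∂(poissonMeasure μ).prod (circleMeasure r)
  beta_reduce at hm
  rw [e] at hm ⊢
  rw [lintegral_map' hm (measurable_id.prodMap hp).aemeasurable]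
  exact Eq.trans (lintegral_congr fun p => mul_comm _ _)
    (lintegral_withDensity_eq_lintegral_mul₀ (hP.comp measurable_fst).aemeasurable hc).symm

theorem hardyNormSq_eq_energy {f : ℂ × ℂ → ℂ} (hf : SepHol f) :
    hardyNormSq f = energy 0 0 circleMeasure circleMeasure f :=
  biSup_congr fun _ hr => energyAt_circle_circle hr hf

/-- By monotonicity in the radius the upper limit in the definition is a limit and a supremum. -/
theorem dirichletFst_eq_energy (μ : Measure UnitCircle) [IsFiniteMeasure μ] {f : ℂ × ℂ → ℂ}
    (hf : SepHol f) :
    dirichletFst μ f = energy 1 0 (fun _ => poissonMeasure μ) circleMeasure f := by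
  have hmono : MonotoneOn (fun r => energyAt 1 0 (fun _ => poissonMeasure μ) circleMeasure r f)
      (Ioo 0 1) := fun r hr s hs hrs =>
    energyAt_mono (admissible_poissonMeasure μ) admissible_circleMeasure hf hr hs hrs
  have h := hmono.tendsto_nhdsWithin_Ioo_left ⟨1 / 2, by norm_num, by norm_num⟩
    (OrderTop.bddAbove _)
  rw [sSup_image] at h
  refine Tendsto.limsup_eq (h.congr' ?_)
  filter_upwards [Ioo_mem_nhdsLT (zero_lt_one' ℝ)] with r hr
  exact (energyAt_poisson_circle μ hr hf).symm

theorem dirichletSnd_eq_energy (μ : Measure UnitCircle) [IsFiniteMeasure μ] {f : ℂ × ℂ → ℂ}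
    (hf : SepHol f) :
    dirichletSnd μ f = energy 0 1 circleMeasure (fun _ => poissonMeasure μ) f := by
  rw [← energy_swap admissible_circleMeasure (admissible_poissonMeasure μ) hf,
    ← dirichletFst_eq_energy μ hf.swap]
  refine congrArg (fun u => limsup u (𝓝[<] 1)) (funext fun r => ?_)
  rw [← lintegral_prod_swap]
  rfl

theorem dirichletMixed_eq_energy (μ₁ μ₂ : Measure UnitCircle) [IsFiniteMeasure μ₁]
    [IsFiniteMeasure μ₂] {f : ℂ × ℂ → ℂ} (hf : SepHol f) :
    dirichletMixed μ₁ μ₂ f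
      = energy 1 1 (fun _ => poissonMeasure μ₁) (fun _ => poissonMeasure μ₂) f := by
  have hP₁ := measurable_poissonIntegral μ₁
  have hP₂ := measurable_poissonIntegral μ₂
  have hr : (1 / 2 : ℝ) ∈ Ioo (0 : ℝ) 1 := ⟨by norm_num, by norm_num⟩
  have h : energy 1 1 (fun _ => poissonMeasure μ₁) (fun _ => poissonMeasure μ₂) f
      = energyAt 1 1 (fun _ => poissonMeasure μ₁) (fun _ => poissonMeasure μ₂) (1 / 2) f :=
    le_antisymm (iSup₂_le fun _ _ => le_rfl) (energyAt_le_energy hr)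
  have hc : AEMeasurable (fun z => ‖partialFst (partialSnd f) z‖ₑ ^ 2)
      (areaMeasure.prod areaMeasure) := by
    refine (ContinuousOn.aemeasurable_of_ae_mem hf.derivSnd.derivFst.continuousOn isOpen_bidisc
      ?_).enorm.pow_const 2
    filter_upwards [Measure.quasiMeasurePreserving_fst.ae ae_mem_disc_areaMeasure,
      Measure.quasiMeasurePreserving_snd.ae ae_mem_disc_areaMeasure] with z h1 h2
    exact ⟨h1, h2⟩
  rw [h]
  change _ = ∫⁻ z, ‖partialFst (partialSnd f) z‖ₑ ^ 2 ∂(poissonMeasure μ₁).prod (poissonMeasure μ₂)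
  rw [poissonMeasure, poissonMeasure, prod_withDensity hP₁ hP₂]
  exact Eq.trans (lintegral_congr fun p => mul_comm _ _)
    (lintegral_withDensity_eq_lintegral_mul₀
      ((hP₁.comp measurable_fst).mul (hP₂.comp measurable_snd)).aemeasurable hc).symm

/-! ### Finiteness of the Hardy norm -/

/-- Subharmonicity in each variable and the one-variable comparison bound the Hardy norm by the two
Dirichlet integrals over a disc times a circle. -/
theorem energy_circle_ne_top {μ₁ μ₂ : Measure UnitCircle} [IsFiniteMeasure μ₁] [IsFiniteMeasure μ₂]
    (h₁ : μ₁ ≠ 0) (h₂ : μ₂ ≠ 0) {f : ℂ × ℂ → ℂ} (hf : SepHol f)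
    (hfst : energy 1 0 (fun _ => poissonMeasure μ₁) circleMeasure f ≠ ∞)
    (hsnd : energy 0 1 circleMeasure (fun _ => poissonMeasure μ₂) f ≠ ∞) :
    energy 0 0 circleMeasure circleMeasure f ≠ ∞ := by
  obtain ⟨C₁, hC₁, hle₁⟩ := exists_lintegral_circleMeasure_le μ₁ h₁
  obtain ⟨C₂, hC₂, hle₂⟩ := exists_lintegral_circleMeasure_le μ₂ h₂
  set A := energy 1 0 (fun _ => poissonMeasure μ₁) circleMeasure f
  set B := energy 0 1 circleMeasure (fun _ => poissonMeasure μ₂) f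
  suffices h : energy 0 0 circleMeasure circleMeasure f ≤ (‖f (0, 0)‖ₑ ^ 2 + C₂ * B) + C₁ * A by
    refine ne_top_of_le_ne_top ?_ h
    finiteness
  refine iSup₂_le fun r hr => ?_
  have hc := admissible_circleMeasure
  have hp₁ := admissible_poissonMeasure μ₁
  have hp₂ := admissible_poissonMeasure μ₂
  have hf0 := hf.snd 0 zero_mem_disc
  have hzero : ∫⁻ w, ‖f (0, w)‖ₑ ^ 2 ∂circleMeasure r ≤ ‖f (0, 0)‖ₑ ^ 2 + C₂ * B := by
    refine (hle₂ r hr _ hf0).trans (add_le_add le_rfl (mul_le_mul_right ?_ _))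
    refine le_trans ?_ (energyAt_le_energy hr)
    rw [energyAt, lintegral_prod_symm _ (aemeasurable_sq_enorm hc hp₂ hr hr
      (hf.mixed 0 1).continuousOn)]
    refine lintegral_mono_ae ?_
    filter_upwards [ae_mem_disc_poissonMeasure μ₂] with w hw
    exact enorm_zero_le_lintegral_circleMeasure hr (hf.derivSnd.fst w hw)
  have hA : ∫⁻ w, ∫⁻ z, ‖deriv (fun x => f (x, w)) z‖ₑ ^ 2 ∂poissonMeasure μ₁ ∂circleMeasure r
      ≤ A := by
    refine le_trans (le_of_eq ?_) (energyAt_le_energy hr)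
    rw [energyAt, lintegral_prod_symm _ (aemeasurable_sq_enorm hp₁ hc hr hr
      (hf.mixed 1 0).continuousOn)]
    rfl
  have hm : AEMeasurable (fun w => ‖f (0, w)‖ₑ ^ 2) (circleMeasure r) :=
    (ContinuousOn.aemeasurable_of_ae_mem hf0.continuousOn isOpen_disc
      (ae_mem_disc_circleMeasure hr)).enorm.pow_const 2
  calc energyAt 0 0 circleMeasure circleMeasure r f
      = ∫⁻ w, ∫⁻ z, ‖f (z, w)‖ₑ ^ 2 ∂circleMeasure r ∂circleMeasure r :=
        lintegral_prod_symm _ (aemeasurable_sq_enorm hc hc hr hr (hf.mixed 0 0).continuousOn)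
    _ ≤ ∫⁻ w, (‖f (0, w)‖ₑ ^ 2 + C₁ * ∫⁻ z, ‖deriv (fun x => f (x, w)) z‖ₑ ^ 2
          ∂poissonMeasure μ₁) ∂circleMeasure r := by
        refine lintegral_mono_ae ?_
        filter_upwards [ae_mem_disc_circleMeasure hr] with w hw
        exact hle₁ r hr _ (hf.fst w hw)
    _ = ∫⁻ w, ‖f (0, w)‖ₑ ^ 2 ∂circleMeasure r + C₁ * ∫⁻ w, ∫⁻ z,
          ‖deriv (fun x => f (x, w)) z‖ₑ ^ 2 ∂poissonMeasure μ₁ ∂circleMeasure r := by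
        rw [lintegral_add_left' hm, lintegral_const_mul' _ _ hC₁]
    _ ≤ _ := add_le_add hzero (mul_le_mul_right hA _)

/-! ### Polynomials -/

theorem contDiff_polyFun (p : MvPolynomial (Fin 2) ℂ) : ContDiff ℂ ⊤ (polyFun p) := by
  induction p using MvPolynomial.induction_on with
  | C a =>
    have : polyFun (MvPolynomial.C a) = fun _ => a := by
      ext z
      simp [polyFun]
    rw [this]
    exact contDiff_const
  | add p q hp hq =>
    have : polyFun (p + q) = fun z => polyFun p z + polyFun q z := by
      ext z
      simp [polyFun]
    rw [this]
    exact hp.add hq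
  | mul_X p i hp =>
    have : polyFun (p * MvPolynomial.X i) = fun z => polyFun p z * ![z.1, z.2] i := by
      ext z
      simp [polyFun]
    rw [this]
    refine hp.mul ?_
    fin_cases i
    · exact contDiff_fst
    · exact contDiff_snd

theorem sepHol_polyFun (p : MvPolynomial (Fin 2) ℂ) : SepHol (polyFun p) :=
  DifferentiableOn.sepHol ((contDiff_polyFun p).differentiable (by simp)).differentiableOn

theorem contDiff_partialFst {f : ℂ × ℂ → ℂ} (hf : ContDiff ℂ ⊤ f) :
    ContDiff ℂ ⊤ (partialFst f) := by
  have e : partialFst f = fun z => fderiv ℂ f z (1, 0) := by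
    ext z
    have h1 : HasFDerivAt f (fderiv ℂ f z) (z.1, z.2) :=
      (hf.differentiable (by simp) z).hasFDerivAt
    have h2 : HasDerivAt (fun w : ℂ => (w, z.2)) (1, 0) z.1 :=
      (hasDerivAt_id _).prodMk (hasDerivAt_const _ _)
    exact (HasFDerivAt.comp_hasDerivAt (f := fun w : ℂ => (w, z.2)) z.1 h1 h2).deriv
  rw [e]
  exact (hf.fderiv_right (by simp)).clm_apply contDiff_const

theorem contDiff_partialSnd {f : ℂ × ℂ → ℂ} (hf : ContDiff ℂ ⊤ f) :
    ContDiff ℂ ⊤ (partialSnd f) := by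
  have h : ContDiff ℂ ⊤ (Prod.swap : ℂ × ℂ → ℂ × ℂ) := contDiff_snd.prodMk contDiff_fst
  exact (contDiff_partialFst (hf.comp h)).comp h

/-- Derivatives of polynomials are bounded on the bidisc, and the measures are finite. -/
theorem energy_polyFun_ne_top {i j : ℕ} {α β : ℝ → Measure ℂ} (hα : Admissible i α)
    (hβ : Admissible j β) {A B : ℝ≥0∞} (hA : A ≠ ∞) (hB : B ≠ ∞) (hαA : ∀ r, α r univ ≤ A)
    (hβB : ∀ r, β r univ ≤ B) (p : MvPolynomial (Fin 2) ℂ) :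
    energy i j α β (polyFun p) ≠ ∞ := by
  have hS : ∀ j, ContDiff ℂ ⊤ (partialSnd^[j] (polyFun p)) := fun j => by
    induction j with
    | zero => exact contDiff_polyFun p
    | succ j ih =>
      rw [Function.iterate_succ_apply']
      exact contDiff_partialSnd ih
  have hD : ∀ i, ContDiff ℂ ⊤ (mixedDeriv i j (polyFun p)) := fun i => by
    induction i with
    | zero => exact hS j
    | succ i ih =>
      rw [mixedDeriv, Function.iterate_succ_apply']
      exact contDiff_partialFst ih
  obtain ⟨C, hC⟩ := ((isCompact_closedBall (0 : ℂ) 1).prod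
    (isCompact_closedBall (0 : ℂ) 1)).exists_bound_of_continuousOn (hD i).continuous.continuousOn
  suffices h : energy i j α β (polyFun p) ≤ ENNReal.ofReal C ^ 2 * (A * B) by
    refine ne_top_of_le_ne_top ?_ h
    finiteness
  refine iSup₂_le fun r hr => ?_
  have := hα.sFinite r
  have := hβ.sFinite r
  calc energyAt i j α β r (polyFun p)
      ≤ ∫⁻ _, ENNReal.ofReal C ^ 2 ∂(α r).prod (β r) := by
        refine lintegral_mono_ae ?_
        filter_upwards [ae_mem_bidisc hα hβ hr] with z hz
        rw [← ofReal_norm]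
        gcongr
        exact hC z ⟨Metric.ball_subset_closedBall hz.1, Metric.ball_subset_closedBall hz.2⟩
    _ = ENNReal.ofReal C ^ 2 * (α r univ * β r univ) := by
        rw [lintegral_const, ← univ_prod_univ, Measure.prod_prod]
    _ ≤ _ := by
        gcongr
        · exact hαA r
        · exact hβB r

/-- The Fejér mean in the second variable, the first variable being a parameter. -/
noncomputable def fejerSnd (M : ℕ) (f : ℂ × ℂ → ℂ) : ℂ × ℂ → ℂ :=
  fejerFst M (f ∘ Prod.swap) ∘ Prod.swap

theorem SepHol.fejerMeanSnd {f : ℂ × ℂ → ℂ} (hf : SepHol f) (M : ℕ) : SepHol (fejerSnd M f) :=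
  (hf.swap.fejerMean M).swap

theorem taylorCoeff_sum (m N : ℕ) (c : ℕ → ℂ) {g : ℕ → ℂ → ℂ}
    (hg : ∀ n, DifferentiableOn ℂ (g n) disc) :
    taylorCoeff m (fun x => ∑ n ∈ Finset.range N, c n * g n x)
      = ∑ n ∈ Finset.range N, c n * taylorCoeff m (g n) := by
  have h1 : DifferentiableOn ℂ (fun x => ∑ n ∈ Finset.range N, c n * g n x) disc :=
    DifferentiableOn.fun_sum fun n _ => (hg n).const_mul (c n)
  have h2 : HasTaylor (fun m => ∑ n ∈ Finset.range N, c n * taylorCoeff m (g n))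
      (fun x => ∑ n ∈ Finset.range N, c n * g n x) := fun z hz => by
    have h3 := hasSum_sum (s := Finset.range N) fun n _ =>
      (hasTaylor_taylorCoeff (hg n) z hz).mul_left (c n)
    simp_rw [Finset.sum_mul, mul_assoc]
    exact h3
  exact congrFun ((hasTaylor_taylorCoeff h1).unique h2) m

/-- Iterated Fejér means are polynomials. -/
theorem exists_polyFun_eq_fejer {f : ℂ × ℂ → ℂ} (hf : SepHol f) (M N : ℕ) :
    ∃ p, polyFun p = fejerSnd M (fejerFst N f) := by
  refine ⟨∑ m ∈ Finset.range M, ∑ n ∈ Finset.range N, MvPolynomial.C (fejerWeight M m *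
    (fejerWeight N n * taylorCoeff m fun w => taylorCoeff n fun x => f (x, w)))
      * MvPolynomial.X 0 ^ n * MvPolynomial.X 1 ^ m, ?_⟩
  ext ⟨z, w⟩
  have h1 : ∀ n, DifferentiableOn ℂ (fun w => taylorCoeff n fun x => f (x, w)) disc :=
    fun n w hw => (hf.hasDerivAt_taylorCoeff n hw).differentiableAt.differentiableWithinAt
  have h2 : fejerSnd M (fejerFst N f) (z, w) = ∑ m ∈ Finset.range M, fejerWeight M m
      * taylorCoeff m (fun w => ∑ n ∈ Finset.range N,
        (fejerWeight N n * z ^ n) * taylorCoeff n fun x => f (x, w)) * w ^ m := by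
    simp only [fejerSnd, fejerFst, fejer, Function.comp_apply, Prod.swap_prod_mk]
    refine Finset.sum_congr rfl fun m _ => ?_
    congr 3
    ext y
    exact Finset.sum_congr rfl fun n _ => by ring
  rw [h2]
  simp only [taylorCoeff_sum _ N (fun n => fejerWeight N n * z ^ n) h1, polyFun, map_sum, map_mul,
    map_pow, MvPolynomial.eval_C, MvPolynomial.eval_X, Matrix.cons_val_zero, Matrix.cons_val_one,
    Finset.mul_sum, Finset.sum_mul]
  refine Finset.sum_congr rfl fun m _ => Finset.sum_congr rfl fun n _ => ?_
  ring

/-! ### Density -/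

/-- A functional on separately holomorphic functions that behaves like the square of a seminorm and
in which Fejér means in either variable converge. -/
structure FejerContinuous (E : (ℂ × ℂ → ℂ) → ℝ≥0∞) : Prop where
  tendsto_fst : ∀ f, SepHol f → E f ≠ ∞ → Tendsto (fun N => E (f - fejerFst N f)) atTop (𝓝 0)
  tendsto_snd : ∀ f, SepHol f → E f ≠ ∞ → Tendsto (fun N => E (f - fejerSnd N f)) atTop (𝓝 0)
  add_le : ∀ f g, SepHol f → SepHol g → E (f + g) ≤ 2 * E f + 2 * E g
  sub_le : ∀ f g, SepHol f → SepHol g → E (f - g) ≤ 2 * E f + 2 * E g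

theorem fejerContinuous_energy {i j : ℕ} {α β : ℝ → Measure ℂ} (hα : Admissible i α)
    (hβ : Admissible j β) : FejerContinuous (energy i j α β) where
  tendsto_fst _ hf hfin := tendsto_energy_sub_fejerFst hα hβ hf hfin
  tendsto_snd f hf hfin := by
    have h := tendsto_energy_sub_fejerFst hβ hα hf.swap (by rwa [energy_swap hα hβ hf])
    refine h.congr fun N => ?_
    rw [← energy_swap hα hβ (hf.sub (hf.fejerMeanSnd N))]
    rfl
  add_le _ _ hf hg := le_add_self.trans (energy_sub_add_le hα hβ hf hg)
  sub_le _ _ hf hg := le_self_add.trans (energy_sub_add_le hα hβ hf hg)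

theorem FejerContinuous.add {E F : (ℂ × ℂ → ℂ) → ℝ≥0∞} (hE : FejerContinuous E)
    (hF : FejerContinuous F) : FejerContinuous fun f => E f + F f where
  tendsto_fst f hf h := by
    rw [ENNReal.add_ne_top] at h
    simpa using (hE.tendsto_fst f hf h.1).add (hF.tendsto_fst f hf h.2)
  tendsto_snd f hf h := by
    rw [ENNReal.add_ne_top] at h
    simpa using (hE.tendsto_snd f hf h.1).add (hF.tendsto_snd f hf h.2)
  add_le f g hf hg := (add_le_add (hE.add_le f g hf hg) (hF.add_le f g hf hg)).trans
    (le_of_eq (by ring))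
  sub_le f g hf hg := (add_le_add (hE.sub_le f g hf hg) (hF.sub_le f g hf hg)).trans
    (le_of_eq (by ring))

theorem FejerContinuous.exists_polyFun_lt {E : (ℂ × ℂ → ℂ) → ℝ≥0∞} (hE : FejerContinuous E)
    {f : ℂ × ℂ → ℂ} (hf : SepHol f) (hfin : E f ≠ ∞) {ε : ℝ≥0∞} (hε : ε ≠ 0) :
    ∃ p, E (f - polyFun p) < ε := by
  obtain ⟨δ, hδ, hδε⟩ : ∃ δ, 0 < δ ∧ 2 * δ + 2 * δ ≤ ε := by
    refine ⟨ε / 4, ENNReal.div_pos hε (by norm_num), le_of_eq ?_⟩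
    rw [← add_mul, show (2 : ℝ≥0∞) + 2 = 4 by norm_num]
    exact ENNReal.mul_div_cancel (by norm_num) (by norm_num)
  -- The bound by `1` serves only to keep the energy of the Fejér mean finite, as `δ` may be `∞`.
  obtain ⟨N, hN⟩ := ((hE.tendsto_fst f hf hfin).eventually_lt_const
    (lt_min hδ zero_lt_one)).exists
  rw [lt_min_iff] at hN
  have hg := hf.fejerMean N
  have hgfin : E (fejerFst N f) ≠ ∞ := by
    have h := hE.sub_le f (f - fejerFst N f) hf (hf.sub hg)
    rw [sub_sub_cancel] at h
    refine ne_top_of_le_ne_top ?_ h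
    have := hN.2.ne_top
    finiteness
  obtain ⟨M, hM⟩ := ((hE.tendsto_snd _ hg hgfin).eventually_lt_const hδ).exists
  obtain ⟨p, hp⟩ := exists_polyFun_eq_fejer hf M N
  refine ⟨p, ?_⟩
  have h := hE.add_le (f - fejerFst N f) (fejerFst N f - fejerSnd M (fejerFst N f)) (hf.sub hg)
    (hg.sub (hg.fejerMeanSnd M))
  rw [sub_add_sub_cancel, ← hp] at h
  rw [← hp] at hM
  refine lt_of_le_of_lt h (lt_of_lt_of_le (ENNReal.add_lt_add ?_ ?_) hδε)
  · exact ENNReal.mul_lt_mul_right (by norm_num) (by norm_num) hN.1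
  · exact ENNReal.mul_lt_mul_right (by norm_num) (by norm_num) hM

end BidiscDirichlet

open BidiscDirichlet

theorem mainTheorem5 (μ₁ μ₂ : MeasureTheory.Measure BidiscDirichlet.UnitCircle)
    [MeasureTheory.IsFiniteMeasure μ₁] [MeasureTheory.IsFiniteMeasure μ₂] :
    (∀ p : MvPolynomial (Fin 2) ℂ,
      BidiscDirichlet.polyFun p ∈ BidiscDirichlet.dirichletSpace μ₁ μ₂) ∧
    (∀ f ∈ BidiscDirichlet.dirichletSpace μ₁ μ₂,
      BidiscDirichlet.dirichletNorm μ₁ μ₂ f < ⊤ ∧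
      ∀ ε : ℝ, 0 < ε → ∃ p : MvPolynomial (Fin 2) ℂ,
        BidiscDirichlet.dirichletNorm μ₁ μ₂ (f - BidiscDirichlet.polyFun p)
          < ENNReal.ofReal ε) := by
  have hc := admissible_circleMeasure
  have hp₁ := admissible_poissonMeasure μ₁
  have hp₂ := admissible_poissonMeasure μ₂
  have hpoly : ∀ p, DifferentiableOn ℂ (polyFun p) bidisc := fun p =>
    ((contDiff_polyFun p).differentiable (by simp)).differentiableOn
  have hcirc : ∀ r, circleMeasure r univ ≤ 1 := fun r => prob_le_one
  have hsqrt : ∀ {x : ℝ≥0∞} {ε : ℝ}, x < ENNReal.ofReal ε ^ 2 →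
      x ^ (1 / 2 : ℝ) < ENNReal.ofReal ε := fun {x ε} h => by
    have h1 := ENNReal.rpow_lt_rpow h (by norm_num : (0 : ℝ) < 1 / 2)
    rwa [← ENNReal.rpow_natCast, ← ENNReal.rpow_mul,
      show ((2 : ℕ) : ℝ) * (1 / 2) = 1 by norm_num, ENNReal.rpow_one] at h1
  have hε0 : ∀ {ε : ℝ}, 0 < ε → ENNReal.ofReal ε ^ 2 ≠ 0 := fun h =>
    pow_ne_zero 2 (ENNReal.ofReal_pos.mpr h).ne'
  by_cases h0 : μ₁.prod μ₂ = 0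
  · simp only [dirichletSpace, dirichletNorm, if_pos h0]
    refine ⟨fun p => ⟨hpoly p, ?_⟩, fun f hf => ⟨?_, fun ε hε => ?_⟩⟩
    · rw [hardyNormSq_eq_energy (sepHol_polyFun p)]
      exact (energy_polyFun_ne_top hc hc ENNReal.one_ne_top ENNReal.one_ne_top hcirc hcirc p).lt_top
    · exact ENNReal.rpow_lt_top_of_nonneg (by norm_num) hf.2.ne
    · have hfS := DifferentiableOn.sepHol hf.1
      obtain ⟨p, hp⟩ := (fejerContinuous_energy hc hc).exists_polyFun_lt hfS
        (by rw [← hardyNormSq_eq_energy hfS]; exact hf.2.ne) (hε0 hε)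
      refine ⟨p, hsqrt ?_⟩
      rwa [hardyNormSq_eq_energy (hfS.sub (sepHol_polyFun p))]
  · have h₁ : μ₁ ≠ 0 := by
      rintro rfl
      simp at h0
    have h₂ : μ₂ ≠ 0 := by
      rintro rfl
      simp at h0
    have hD : ∀ {f}, SepHol f → dirichletIntegral μ₁ μ₂ f
        = energy 1 0 (fun _ => poissonMeasure μ₁) circleMeasure f
          + energy 0 1 circleMeasure (fun _ => poissonMeasure μ₂) f
          + energy 1 1 (fun _ => poissonMeasure μ₁) (fun _ => poissonMeasure μ₂) f := fun hf => by
      rw [dirichletIntegral, dirichletFst_eq_energy μ₁ hf, dirichletSnd_eq_energy μ₂ hf,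
        dirichletMixed_eq_energy μ₁ μ₂ hf]
    have hfin : ∀ f, SepHol f → dirichletIntegral μ₁ μ₂ f < ∞ →
        hardyNormSq f + dirichletIntegral μ₁ μ₂ f ≠ ∞ := fun f hf h => by
      refine ENNReal.add_ne_top.mpr ⟨?_, h.ne⟩
      rw [hD hf] at h
      have h1 := ENNReal.add_ne_top.mp (ENNReal.add_ne_top.mp h.ne).1
      rw [hardyNormSq_eq_energy hf]
      exact energy_circle_ne_top h₁ h₂ hf h1.1 h1.2
    simp only [dirichletSpace, dirichletNorm, if_neg h0]
    refine ⟨fun p => ⟨hpoly p, ?_⟩, fun f hf => ⟨?_, fun ε hε => ?_⟩⟩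
    · have hm₁ := measure_ne_top (poissonMeasure μ₁) univ
      have hm₂ := measure_ne_top (poissonMeasure μ₂) univ
      rw [hD (sepHol_polyFun p)]
      refine (ENNReal.add_ne_top.mpr ⟨ENNReal.add_ne_top.mpr ⟨?_, ?_⟩, ?_⟩).lt_top
      · exact energy_polyFun_ne_top hp₁ hc hm₁ ENNReal.one_ne_top (fun _ => le_rfl) hcirc p
      · exact energy_polyFun_ne_top hc hp₂ ENNReal.one_ne_top hm₂ hcirc (fun _ => le_rfl) p
      · exact energy_polyFun_ne_top hp₁ hp₂ hm₁ hm₂ (fun _ => le_rfl) (fun _ => le_rfl) p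
    · exact ENNReal.rpow_lt_top_of_nonneg (by norm_num)
        (hfin f (DifferentiableOn.sepHol hf.1) hf.2)
    · have hfS := DifferentiableOn.sepHol hf.1
      have hE := (fejerContinuous_energy hc hc).add (((fejerContinuous_energy hp₁ hc).add
        (fejerContinuous_energy hc hp₂)).add (fejerContinuous_energy hp₁ hp₂))
      obtain ⟨p, hp⟩ := hE.exists_polyFun_lt hfS
        (by rw [← hardyNormSq_eq_energy hfS, ← hD hfS]; exact hfin f hfS hf.2) (hε0 hε)
      refine ⟨p, hsqrt ?_⟩
      have hfp := hfS.sub (sepHol_polyFun p)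
      rwa [hardyNormSq_eq_energy hfp, hD hfp]
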